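/- Let $k$ be a field. By a hereditary abelian category we mean a $k$-linear abelian category $\mathcal H$ with $\operatorname{Ext}^2_{\mathcal H}(-,-)=0$ all of whose spaces $\operatorname{Hom}_{\mathcal H}(X,Y)$ and $\operatorname{Ext}^n_{\mathcal H}(X,Y)$ are finite-dimensional over $k$. An object $T$ of the bounded derived category $\mathcal D^b(\mathcal H)$ is a \emph{silting complex} over $\mathcal H$ if $\operatorname{Hom}(T,T[n])=0$ for all $n>0$ and the smallest thick subcategory containing $T$ is $\mathcal D^b(\mathcal H)$. It is \emph{$2$-term} if moreover $\operatorname{Hom}(T,M[i])=0$ for all $M\in\mathcal H$ and all integers $i\neq 0,1$, and \emph{basic} if it is a finite direct sum of pairwise non-isomorphic indecomposable objects. Let $\mathcal E$ be the class of $k$-algebras isomorphic to $\operatorname{End}_{\mathcal D^b(\mathcal H)}(T)$ for some basic silting complex $T$ over some hereditary abelian category $\mathcal H$; such an algebra is \emph{quasi-silted} if $\mathcal H$ and $T$ can be chosen with $T$ basic and $2$-term silting. For $D\in\mathcal D^b(\mathcal H)$ put \[ D^{\perp_{\mathbb Z}}=\{M\in\mathcal H \mid \operatorname{Hom}_{\mathcal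 D^b(\mathcal H)}(D,M[i])=0 \text{ for all } i\in\mathbb Z\}. \] \textbf{Theorem.} Let $A$ be a $k$-algebra and $e\in A$ an idempotent. \begin{enumerate} \item[(a)] If $A\in\mathcal E$, then $A/AeA\in\mathcal E$. \item[(b)] If $A$ is quasi-silted, then $A/AeA$ is quasi-silted. \item[(c)] More precisely, let $\mathcal H$ be a hereditary abelian category, $T$ a silting complex over $\mathcal H$, and $A\cong\operatorname{End}_{\mathcal D^b(\mathcal H)}(T)$. Then $e$ is the idempotent of a direct summand $D$ of $T$ (that is, the endomorphism of $T$ corresponding to $e$ factors as $T\xrightarrow{r}D\xrightarrow{i}T$ with $r\circ i=\mathrm{id}_D$), the full subcategory $D^{\perp_{\mathbb Z}}$ of $\mathcal H$ contains $0$ and is closed under kernels, cokernels and finite direct sums, it is a hereditary abelian category in the above sense, and there is a silting complex $T'$ over $D^{\perp_{\mathbb Z}}$ with $A/AeA\cong\operatorname{End}_{\mathcal D^b(D^{\perp_{\mathbb Z}})}(T')$ as $k$-algebras, such that $T'$ is basic if $T$ is basic and $T'$ is $2$-term if $T$ is $2$-term. \end{enumerate} -/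

import Mathlib

open CategoryTheory CategoryTheory.Limits CategoryTheory.Abelian

universe v u

/- Derived categories are taken in their standard (localization) model. -/
attribute [local instance] HasDerivedCategory.standard

namespace SiltingQuotient

section Triangulated

variable {C : Type u} [Category.{v} C] [HasZeroObject C] [HasShift C ℤ] [Preadditive C]
  [∀ n : ℤ, (shiftFunctor C n).Additive] [Pretriangulated C]

/-- `T` is presilting: `Hom(T, T[n]) = 0` for all `n > 0`. -/
def IsPresilting (T : C) : Prop :=
  ∀ n : ℤ, 0 < n → ∀ f : T ⟶ T⟦n⟧, f = 0

/-- `T` is silting: it is presilting and the smallest thick subcategory containing `T`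
is the whole category. -/
def IsSilting (T : C) : Prop :=
  IsPresilting T ∧ (ObjectProperty.singleton T).triangEnvelope = ⊤

/-- `T` is basic: it is a finite direct sum of pairwise non-isomorphic indecomposable objects. -/
def IsBasic (T : C) : Prop :=
  ∃ (n : ℕ) (X : Fin n → C), (∀ i, Indecomposable (X i)) ∧
    (∀ i j, i ≠ j → IsEmpty (X i ≅ X j)) ∧ Nonempty (T ≅ ⨁ X)

end Triangulated

section Hereditary

/-- The `k`-linear abelian category `H` is hereditary, Hom-finite and Ext-finite. -/
structure IsFiniteHereditary (k : Type*) [Field k]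
    (H : Type u) [Category.{v} H] [Abelian H] [Linear k H] : Prop where
  hom_finite : ∀ X Y : H, Module.Finite k (X ⟶ Y)
  ext_finite : letI := HasExt.standard H
    ∀ (X Y : H) (n : ℕ), Module.Finite k (Ext.{max u v} X Y n)
  ext_two : letI := HasExt.standard H
    ∀ X Y : H, Subsingleton (Ext.{max u v} X Y 2)

variable {H : Type u} [Category.{v} H] [Abelian H]

/-- `T` is two-term: `Hom(T, M[i]) = 0` for all `M` in `H` and all `i ≠ 0, 1`. -/
def IsTwoTerm (T : DerivedCategory.Bounded H) : Prop :=
  ∀ (M : H) (i : ℤ), i ≠ 0 → i ≠ 1 →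
    ∀ f : T.obj ⟶ ((DerivedCategory.singleFunctor H 0).obj M)⟦i⟧, f = 0

/-- The full subcategory of those `M` in `H` with `Hom(D, M[i]) = 0` for all integers `i`. -/
def perpZ (D : DerivedCategory.Bounded H) : ObjectProperty H :=
  fun M => ∀ (i : ℤ) (f : D.obj ⟶ ((DerivedCategory.singleFunctor H 0).obj M)⟦i⟧), f = 0

end Hereditary

/-- The `k`-algebra `A` is isomorphic to the endomorphism algebra of a basic silting complex
over some hereditary abelian category. -/
def IsSiltingEndAlgebra (k : Type*) [Field k] (A : Type*) [Ring A] [Algebra k A] : Prop :=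
  ∃ (H : Type u) (_ : Category.{v} H) (_ : Abelian H) (_ : Linear k H)
    (T : DerivedCategory.Bounded H),
    IsFiniteHereditary k H ∧ IsSilting T ∧ IsBasic T ∧ Nonempty (A ≃ₐ[k] End T)

/-- The `k`-algebra `A` is quasi-silted: it is isomorphic to the endomorphism algebra of a basic
two-term silting complex over some hereditary abelian category. -/
def IsQuasiSilted (k : Type*) [Field k] (A : Type*) [Ring A] [Algebra k A] : Prop :=
  ∃ (H : Type u) (_ : Category.{v} H) (_ : Abelian H) (_ : Linear k H)
    (T : DerivedCategory.Bounded H),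
    IsFiniteHereditary k H ∧ IsSilting T ∧ IsTwoTerm T ∧ IsBasic T ∧ Nonempty (A ≃ₐ[k] End T)

/-- The quotient algebra `A / AeA`. -/
abbrev IdemQuotient {A : Type*} [Ring A] (e : A) : Type _ :=
  (TwoSidedIdeal.span {e}).ringCon.Quotient

end SiltingQuotient

set_option linter.unusedSectionVars false

/-! The silting complex `T` is reduced along its summand `D`, the splitting of `e`. Let `L` be the
left adjoint of the inclusion of `shiftPerp D`, the objects receiving no nonzero map from any shift
of `D`. The reflection of `X` is built by coning off approximations by `D⟦s₀⟧`, `D⟦s₀ + 1⟧`, and so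
on; as `D` is presilting, a later cone never revives maps from an earlier shift. Heredity ends the
process after finitely many steps: truncation triangles split, and the low-degree part, to which `X`
has no maps, can be discarded (`IsBoundedHereditary.exists_reflection`).

For `X = T` only the first cone, by copies of `D` itself, is visible to maps out of `T`. Hence `End
T → End (L T)` is surjective, and its kernel consists of the sums of maps through `D`, which is
`AeA`. The same lifting of maps shows that `L T` is presilting; it generates because `L` is
essentially surjective. Local endomorphism rings carry basicness over (`IsBasic.map`), and the
adjunction carries over the two-term condition. All this is `exists_silting_reduction`.

It remains to identify `shiftPerp D` with the bounded derived category of `perpZ D`. Since `Ext² =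
0`, the subcategory `perpZ D` contains the images of its morphisms (`perpZ_of_epi_of_mono`), hence
their kernels and cokernels; it is also closed under extensions. Its inclusion is therefore exact,
bijective on `Ext⁰` and `Ext¹` and injective on `Ext²`. So `perpZ D` is hereditary, and the derived
inclusion is fully faithful on bounded complexes (`isHomBijective_bounded`). Its image is `shiftPerp
D`, because objects decompose into shifts of objects of the heart (`essImage_mapBounded_iff`). Parts
(a) and (b) are special cases of (c). -/

namespace SiltingQuotient

open Pretriangulated Triangulated

/-! ### Perpendicular subcategories and hereditary bounded t-structures -/

section Hereditary

variable {C : Type u} [Category.{v} C] [HasZeroObject C] [HasShift C ℤ] [Preadditive C]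
  [∀ n : ℤ, (shiftFunctor C n).Additive] [Pretriangulated C]

section Exactness

variable {X Y Z A : C} {f : X ⟶ Y} {g : Y ⟶ Z} {h : Z ⟶ X⟦(1 : ℤ)⟧}

lemma exists_desc₂ (hT : Triangle.mk f g h ∈ distTriang C) (φ : Y ⟶ A) (hφ : f ≫ φ = 0) :
    ∃ ψ : Z ⟶ A, g ≫ ψ = φ := by
  obtain ⟨ψ, hψ⟩ := Triangle.yoneda_exact₂ _ hT φ hφ
  exact ⟨ψ, hψ.symm⟩

lemma exists_desc₃ (hT : Triangle.mk f g h ∈ distTriang C) (φ : Z ⟶ A) (hφ : g ≫ φ = 0) :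
    ∃ ψ : X⟦(1 : ℤ)⟧ ⟶ A, h ≫ ψ = φ := by
  obtain ⟨ψ, hψ⟩ := Triangle.yoneda_exact₃ _ hT φ hφ
  exact ⟨ψ, hψ.symm⟩

lemma exists_lift₂ (hT : Triangle.mk f g h ∈ distTriang C) (φ : A ⟶ Y) (hφ : φ ≫ g = 0) :
    ∃ ψ : A ⟶ X, ψ ≫ f = φ := by
  obtain ⟨ψ, hψ⟩ := Triangle.coyoneda_exact₂ _ hT φ hφ
  exact ⟨ψ, hψ.symm⟩

lemma exists_lift₃ (hT : Triangle.mk f g h ∈ distTriang C) (φ : A ⟶ Z) (hφ : φ ≫ h = 0) :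
    ∃ ψ : A ⟶ Y, ψ ≫ g = φ := by
  obtain ⟨ψ, hψ⟩ := Triangle.coyoneda_exact₃ _ hT φ hφ
  exact ⟨ψ, hψ.symm⟩

end Exactness

/-- The objects `Y` such that `Hom(D⟦s⟧, Y) = 0` for all integers `s`. -/
def shiftPerp (D : C) : ObjectProperty C :=
  fun Y => ∀ (s : ℤ) (f : D⟦s⟧ ⟶ Y), f = 0

lemma hom_shift_eq_zero_iff (D Y : C) (s : ℤ) :
    (∀ f : D⟦s⟧ ⟶ Y, f = 0) ↔ ∀ f : D ⟶ Y⟦-s⟧, f = 0 := by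
  let e := (shiftEquiv C s).toAdjunction.homEquiv D Y
  constructor
  · intro h f
    apply e.symm.injective
    exact (h _).trans (h _).symm
  · intro h f
    apply e.injective
    exact (h _).trans (h _).symm

lemma shiftPerp_iff (D Y : C) :
    shiftPerp D Y ↔ ∀ (i : ℤ) (f : D ⟶ Y⟦i⟧), f = 0 := by
  constructor
  · intro h i
    obtain ⟨s, rfl⟩ : ∃ s : ℤ, i = -s := ⟨-i, by simp⟩
    exact (hom_shift_eq_zero_iff D Y s).1 (h s)
  · intro h s
    exact (hom_shift_eq_zero_iff D Y s).2 (h (-s))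

/-- The right orthogonal of a shift-stable class is a triangulated subcategory, which gives the
instance below. -/
lemma shiftPerp_eq_rightOrthogonal (D : C) :
    shiftPerp D = ((ObjectProperty.singleton D).shiftClosure ℤ).rightOrthogonal := by
  ext Y
  constructor
  · rintro h X f ⟨Z, s, e, ⟨_⟩⟩
    rw [← cancel_epi e.inv, comp_zero]
    exact h s _
  · intro h s f
    exact h f ⟨D, s, Iso.refl _, by simp⟩

instance (D : C) : (shiftPerp D).IsTriangulated := by
  rw [shiftPerp_eq_rightOrthogonal]
  infer_instance

instance (D : C) : (shiftPerp D).IsStableUnderRetracts where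
  of_retract := by
    intro X Y r h s f
    rw [← Category.comp_id f, ← r.retract, reassoc_of% (h s (f ≫ r.i)), zero_comp]

/-- If `D` is presilting then `Hom(D⟦a⟧, D⟦b⟧) = 0` for `a < b`. -/
lemma IsPresilting.hom_shift_eq_zero {D T : C} (h : ∀ n : ℤ, 0 < n → ∀ f : T ⟶ D⟦n⟧, f = 0)
    {a b : ℤ} (hab : a < b) (f : T⟦a⟧ ⟶ D⟦b⟧) : f = 0 := by
  refine (hom_shift_eq_zero_iff T (D⟦b⟧) a).2 (fun g => ?_) f
  rw [← cancel_mono ((shiftFunctorAdd C b (-a)).inv.app D), zero_comp]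
  exact h (b + -a) (by lia) _

variable (t : TStructure C)

/-- A bounded t-structure is hereditary if there are no nonzero morphisms from objects that are
`≥ a` to objects that are `≤ a - 2`. -/
structure IsBoundedHereditary : Prop where
  exists_isGE : ∀ X : C, ∃ a, t.IsGE X a
  exists_isLE : ∀ X : C, ∃ b, t.IsLE X b
  hom_eq_zero : ∀ {X Y : C} (a b : ℤ), b + 2 ≤ a → t.IsGE X a → t.IsLE Y b →
    ∀ f : X ⟶ Y, f = 0

variable {t}

section
variable [IsTriangulated C]

/-- Dévissage along truncation triangles. -/
lemma tStructure_induction (P : C → Prop)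
    (h₀ : ∀ (n : ℤ) (X : C), t.IsGE X n → t.IsLE X n → P X)
    (h₁ : ∀ (n : ℤ) (T : Triangle C), T ∈ distTriang C → t.IsLE T.obj₁ n →
      t.IsGE T.obj₃ (n + 1) →
      (∀ a, t.IsGE T.obj₂ a → t.IsGE T.obj₁ a ∧ t.IsGE T.obj₃ a) →
      (∀ b, t.IsLE T.obj₂ b → t.IsLE T.obj₁ b ∧ t.IsLE T.obj₃ b) →
      P T.obj₁ → P T.obj₃ → P T.obj₂) (X : C)
    (hX : t.bounded X) : P X := by
  obtain ⟨⟨a, ha⟩, ⟨b, hb⟩⟩ := hX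
  obtain ⟨n, hn⟩ : ∃ n : ℕ, b ≤ a + n := ⟨(b - a).toNat, by lia⟩
  induction n generalizing X b with
  | zero =>
    exact h₀ a X ha (t.isLE_of_le X b a (by simpa using hn))
  | succ n ih =>
    have := t.isLE_of_le X b (a + n + 1) (by push_cast at hn; lia)
    refine h₁ (a + n) _ (t.triangleLEGE_distinguished (a + n) (a + n + 1) rfl X)
      (inferInstanceAs (t.IsLE ((t.truncLE (a + n)).obj X) _))
      (inferInstanceAs (t.IsGE ((t.truncGE (a + n + 1)).obj X) _))
      (fun c (hc : t.IsGE X c) => ⟨inferInstanceAs (t.IsGE ((t.truncLE (a + n)).obj X) _),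
        inferInstanceAs (t.IsGE ((t.truncGE (a + n + 1)).obj X) _)⟩)
      (fun c (hc : t.IsLE X c) => ⟨inferInstanceAs (t.IsLE ((t.truncLE (a + n)).obj X) _),
        inferInstanceAs (t.IsLE ((t.truncGE (a + n + 1)).obj X) _)⟩) ?_ ?_
    · exact ih _ (inferInstanceAs (t.IsGE ((t.truncLE (a + n)).obj X) _)) (a + n)
        (inferInstanceAs (t.IsLE ((t.truncLE (a + n)).obj X) _)) (by simp)
    · exact h₀ (a + n + 1) _ (inferInstanceAs (t.IsGE ((t.truncGE (a + n + 1)).obj X) _))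
        (inferInstanceAs (t.IsLE ((t.truncGE (a + n + 1)).obj X) _))

end

namespace IsBoundedHereditary

variable (ht : IsBoundedHereditary t)
include ht

lemma bounded (X : C) : t.bounded X := ⟨ht.exists_isGE X, ht.exists_isLE X⟩

/-- The shift moves the first vertex to degrees at most `n - 1`, exactly two below the third, so
heredity applies. This is why all truncation triangles split. -/
lemma mor₃_eq_zero {T : Triangle C} (n : ℤ)
    (h₁ : t.IsLE T.obj₁ n) (h₃ : t.IsGE T.obj₃ (n + 1)) : T.mor₃ = 0 :=
  ht.hom_eq_zero (n + 1) (n - 1) (by lia) h₃ (t.isLE_shift T.obj₁ n 1 (n - 1)) _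

lemma exists_section {T : Triangle C} (hT : T ∈ distTriang C) (n : ℤ)
    (h₁ : t.IsLE T.obj₁ n) (h₃ : t.IsGE T.obj₃ (n + 1)) :
    ∃ σ : T.obj₃ ⟶ T.obj₂, σ ≫ T.mor₂ = 𝟙 _ := by
  obtain ⟨σ, hσ⟩ := T.coyoneda_exact₃ hT (𝟙 _) (by simp [ht.mor₃_eq_zero n h₁ h₃])
  exact ⟨σ, hσ.symm⟩

lemma exists_splitting {T : Triangle C} (hT : T ∈ distTriang C) (n : ℤ)
    (h₁ : t.IsLE T.obj₁ n) (h₃ : t.IsGE T.obj₃ (n + 1)) :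
    ∃ (σ : T.obj₃ ⟶ T.obj₂) (ρ : T.obj₂ ⟶ T.obj₁), σ ≫ T.mor₂ = 𝟙 _ ∧ T.mor₁ ≫ ρ = 𝟙 _ ∧
      ρ ≫ T.mor₁ + T.mor₂ ≫ σ = 𝟙 _ ∧ σ ≫ ρ = 0 := by
  obtain ⟨σ, hσ⟩ := ht.exists_section hT n h₁ h₃
  have h12 := comp_distTriang_mor_zero₁₂ _ hT
  have : Mono T.mor₁ := T.mono₁ hT (ht.mor₃_eq_zero n h₁ h₃)
  obtain ⟨ρ, hρ⟩ := T.coyoneda_exact₂ hT (𝟙 _ - T.mor₂ ≫ σ) (by simp [hσ])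
  refine ⟨σ, ρ, hσ, ?_, ?_, ?_⟩
  · rw [← cancel_mono T.mor₁, Category.assoc, ← hρ]
    simp [reassoc_of% h12]
  · rw [← hρ]; simp
  · rw [← cancel_mono T.mor₁, Category.assoc, ← hρ]
    simp [reassoc_of% hσ]

lemma retract_of_distTriang {P : ObjectProperty C} [P.IsStableUnderRetracts]
    {T : Triangle C} (hT : T ∈ distTriang C) (n : ℤ)
    (h₁ : t.IsLE T.obj₁ n) (h₃ : t.IsGE T.obj₃ (n + 1)) (h₂ : P T.obj₂) :
    P T.obj₁ ∧ P T.obj₃ := by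
  obtain ⟨σ, ρ, h1, h2, -, -⟩ := ht.exists_splitting hT n h₁ h₃
  exact ⟨P.prop_of_retract ⟨T.mor₁, ρ, h2⟩ h₂, P.prop_of_retract ⟨σ, T.mor₂, h1⟩ h₂⟩

end IsBoundedHereditary
end Hereditary

/-! ### Approximation cones, reflections, and splitting of idempotents -/

section Reflection

variable {C : Type u} [Category.{v} C] [HasZeroObject C] [HasShift C ℤ] [Preadditive C]
  [∀ n : ℤ, (shiftFunctor C n).Additive] [Pretriangulated C]

/-- A morphism which is a finite sum of morphisms factoring through `Z`. -/
def IsSumThrough (Z : C) {X Y : C} (f : X ⟶ Y) : Prop :=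
  ∃ (n : ℕ) (a : Fin n → (X ⟶ Z)) (b : Fin n → (Z ⟶ Y)), f = ∑ i, a i ≫ b i

lemma shift_biproduct_ext {n : ℕ} {Z A : C} (h : ∀ f : A ⟶ Z⟦(1 : ℤ)⟧, f = 0)
    (f : A ⟶ (⨁ fun _ : Fin n => Z)⟦(1 : ℤ)⟧) : f = 0 := by
  have := congrArg (fun g => g⟦(1 : ℤ)⟧') (biproduct.total (f := fun _ : Fin n => Z))
  beta_reduce at this
  rw [Functor.map_sum, CategoryTheory.Functor.map_id] at this
  rw [← Category.comp_id f, ← this, Preadditive.comp_sum]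
  refine Finset.sum_eq_zero fun i _ => ?_
  rw [Functor.map_comp, ← Category.assoc, h (f ≫ _), zero_comp]

lemma biproduct_shift_ext {n : ℕ} {Z A : C} (h : ∀ f : Z⟦(1 : ℤ)⟧ ⟶ A, f = 0)
    (f : (⨁ fun _ : Fin n => Z)⟦(1 : ℤ)⟧ ⟶ A) : f = 0 := by
  have := congrArg (fun g => g⟦(1 : ℤ)⟧') (biproduct.total (f := fun _ : Fin n => Z))
  beta_reduce at this
  rw [Functor.map_sum, CategoryTheory.Functor.map_id] at this
  rw [← Category.id_comp f, ← this, Preadditive.sum_comp]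
  refine Finset.sum_eq_zero fun i _ => ?_
  rw [Functor.map_comp, Category.assoc]
  exact (congrArg _ (h _)).trans comp_zero

/-- The cone of a right approximation of `X` by finite direct sums of copies of `Z`. -/
lemma exists_approximation_cone (k : Type*) [Field k] [Linear k C] (Z X : C)
    [Module.Finite k (Z ⟶ X)] :
    ∃ (X' : C) (p : X ⟶ X'), (∀ f : Z ⟶ X, f ≫ p = 0) ∧
      (∀ Y, (∀ f : Z ⟶ Y, f = 0) → ∀ g : X ⟶ Y, ∃ g' : X' ⟶ Y, p ≫ g' = g) ∧
      (∀ Y, (∀ f : Z⟦(1 : ℤ)⟧ ⟶ Y, f = 0) → ∀ g : X' ⟶ Y, p ≫ g = 0 → g = 0) ∧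
      (∀ A, (∀ f : A ⟶ Z⟦(1 : ℤ)⟧, f = 0) → ∀ g : A ⟶ X', ∃ g' : A ⟶ X, g' ≫ p = g) ∧
      (∀ A (f : A ⟶ X), f ≫ p = 0 → IsSumThrough Z f) := by
  obtain ⟨n, g, hg⟩ := Module.Finite.exists_fin (R := k) (M := (Z ⟶ X))
  obtain ⟨X', p, δ, hT⟩ := distinguished_cocone_triangle (biproduct.desc g)
  have h12 : biproduct.desc g ≫ p = 0 := comp_distTriang_mor_zero₁₂ _ hT
  have hgp : ∀ i, g i ≫ p = 0 := fun i => by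
    have := biproduct.ι (fun _ : Fin n => Z) i ≫= h12
    simpa using this
  refine ⟨X', p, ?_, ?_, ?_, ?_, ?_⟩
  · intro f
    have : f ∈ Submodule.span k (Set.range g) := by rw [hg]; trivial
    induction this using Submodule.span_induction with
    | mem x h => obtain ⟨i, rfl⟩ := h; exact hgp i
    | zero => simp
    | add x y _ _ hx hy => simp [hx, hy]
    | smul a x _ hx => simp [hx]
  · intro Y hY f
    refine exists_desc₂ hT f (biproduct.hom_ext' _ _ fun i => ?_)
    rw [comp_zero]
    exact hY _
  · intro Y hY f hf
    obtain ⟨f', rfl⟩ := exists_desc₃ hT f hf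
    rw [biproduct_shift_ext hY f', comp_zero]
  · intro A hA f
    exact exists_lift₃ hT f (shift_biproduct_ext hA _)
  · intro A f hf
    obtain ⟨f', rfl⟩ := exists_lift₂ hT f hf
    refine ⟨n, fun i => f' ≫ biproduct.π _ i, g, ?_⟩
    rw [← Category.id_comp (biproduct.desc g), ← biproduct.total, Preadditive.sum_comp,
      Preadditive.comp_sum]
    simp

lemma hom_shift_shift_eq_zero {A D : C} {s : ℤ} (h : ∀ f : A ⟶ D⟦s + 1⟧, f = 0)
    (f : A ⟶ D⟦s⟧⟦(1 : ℤ)⟧) : f = 0 := by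
  rw [← cancel_mono ((shiftFunctorAdd C s 1).inv.app D), zero_comp]
  exact h _

lemma shift_shift_hom_eq_zero {A D : C} {s : ℤ} (h : ∀ f : D⟦s + 1⟧ ⟶ A, f = 0)
    (f : D⟦s⟧⟦(1 : ℤ)⟧ ⟶ A) : f = 0 := by
  rw [← cancel_epi ((shiftFunctorAdd C s 1).hom.app D), comp_zero]
  exact h _

/-- Iterated approximation cones by the shifts `D⟦s₀⟧, …, D⟦s₀ + n - 1⟧` of a presilting
object `D`. -/
lemma exists_approximation_tower (k : Type*) [Field k] [Linear k C]
    (hfin : ∀ X Y : C, Module.Finite k (X ⟶ Y)) {D : C} (hD : IsPresilting D) (X : C) (s₀ : ℤ)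
    (hX : ∀ s < s₀, ∀ f : D⟦s⟧ ⟶ X, f = 0) (n : ℕ) :
    ∃ (X' : C) (p : X ⟶ X'), (∀ s < s₀ + n, ∀ f : D⟦s⟧ ⟶ X', f = 0) ∧
      (∀ Y, shiftPerp D Y → Function.Bijective (fun g : X' ⟶ Y => p ≫ g)) ∧
      (n = 0 → ∃ r : X' ⟶ X, p ≫ r = 𝟙 X) ∧
      ∀ A : C, (∀ s > s₀, ∀ f : A ⟶ D⟦s⟧, f = 0) →
        (∀ g : A ⟶ X', ∃ g' : A ⟶ X, g' ≫ p = g) ∧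
        (∀ f : A ⟶ X, f ≫ p = 0 → IsSumThrough (D⟦s₀⟧) f) := by
  induction n with
  | zero =>
    refine ⟨X, 𝟙 X, by simpa using hX,
      fun Y _ => ⟨fun _ _ h => by simpa using h, fun g => ⟨g, by simp⟩⟩, fun _ => ⟨𝟙 X, by simp⟩,
      fun A _ => ⟨fun g => ⟨g, by simp⟩, fun f hf => ⟨0, Fin.elim0, Fin.elim0, ?_⟩⟩⟩
    simpa using hf
  | succ n ih =>
    obtain ⟨X₁, p, hp₁, hp₂, hp₀, hp₃⟩ := ih
    have := hfin (D⟦s₀ + n⟧) X₁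
    obtain ⟨X₂, q, hq₁, hq₂, hq₃, hq₄, hq₅⟩ := exists_approximation_cone k (D⟦s₀ + n⟧) X₁
    refine ⟨X₂, p ≫ q, ?_, ?_, by simp, ?_⟩
    · intro s hs f
      -- As `s < s₀ + n + 1` and `D` is presilting, every map `D⟦s⟧ ⟶ X₂` lifts to `X₁`. There it
      -- vanishes by induction if `s < s₀ + n`; if `s = s₀ + n`, it is killed by the new cone.
      obtain ⟨f', rfl⟩ := hq₄ (D⟦s⟧) (hom_shift_shift_eq_zero fun g =>
        IsPresilting.hom_shift_eq_zero hD (by push_cast at hs; lia) g) f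
      obtain hs | rfl : s < s₀ + n ∨ s = s₀ + n := by push_cast at hs; lia
      · rw [hp₁ s hs f', zero_comp]
      · exact hq₁ f'
    · intro Y hY
      constructor
      · intro g₁ g₂ h
        simp only [Category.assoc] at h
        have h' := (hp₂ Y hY).1 h
        rw [← sub_eq_zero]
        refine hq₃ Y (shift_shift_hom_eq_zero (hY _)) _ ?_
        simpa [sub_eq_zero] using h'
      · intro g
        obtain ⟨g₁, rfl⟩ := (hp₂ Y hY).2 g
        obtain ⟨g₂, rfl⟩ := hq₂ Y (hY _) g₁
        exact ⟨g₂, by simp⟩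
    · intro A hA
      refine ⟨fun g => ?_, fun f hf => ?_⟩
      · obtain ⟨g₁, rfl⟩ := hq₄ A (hom_shift_shift_eq_zero (hA _ (by lia))) g
        obtain ⟨g₂, rfl⟩ := (hp₃ A hA).1 g₁
        exact ⟨g₂, by simp⟩
      · rw [← Category.assoc] at hf
        -- Only the first cone contributes to the kernel, since `A` has no maps to `D⟦s⟧` for `s >
        -- s₀`. In that first step the retraction `r` turns a factorization of `f ≫ p` into one of
        -- `f`.
        obtain _ | n := n
        · obtain ⟨r, hr⟩ := hp₀ rfl
          simp only [Nat.cast_zero, add_zero] at hq₅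
          obtain ⟨m, a, b, hab⟩ := hq₅ A _ hf
          refine ⟨m, a, fun i => b i ≫ r, ?_⟩
          rw [← Category.comp_id f, ← hr, reassoc_of% hab, Preadditive.sum_comp]
          simp
        · obtain ⟨m, a, b, hab⟩ := hq₅ A _ hf
          refine (hp₃ A hA).2 f ?_
          rw [hab]
          exact Finset.sum_eq_zero fun i _ => by
            rw [hA _ (by push_cast; lia) (a i), zero_comp]

section

variable {t : TStructure C} [IsTriangulated C]

/-- For a presilting object `D`, every object `X` has a reflection `p : X ⟶ X'` in the subcategory
`shiftPerp D`. -/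
lemma IsBoundedHereditary.exists_reflection (ht : IsBoundedHereditary t)
    (k : Type*) [Field k] [Linear k C]
    (hfin : ∀ X Y : C, Module.Finite k (X ⟶ Y)) {D : C} (hD : IsPresilting D) (X : C) (s₀ : ℤ)
    (hX : ∀ s < s₀, ∀ f : D⟦s⟧ ⟶ X, f = 0) :
    ∃ (X' : C) (p : X ⟶ X'), shiftPerp D X' ∧
      (∀ Y, shiftPerp D Y → Function.Bijective (fun g : X' ⟶ Y => p ≫ g)) ∧
      ∀ A : C, (∀ s > s₀, ∀ f : A ⟶ D⟦s⟧, f = 0) →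
        (∀ g : A ⟶ X', ∃ g' : A ⟶ X, g' ≫ p = g) ∧
        (∀ f : A ⟶ X, f ≫ p = 0 → IsSumThrough (D⟦s₀⟧) f) := by
  obtain ⟨a, ha⟩ := ht.exists_isGE X
  obtain ⟨d, hd⟩ := ht.exists_isLE D
  obtain ⟨n, hn⟩ : ∃ n : ℕ, d + 2 - a ≤ s₀ + n := ⟨(d + 2 - a - s₀).toNat, by lia⟩
  obtain ⟨X₁, p, hp₁, hp₂, -, hp₃⟩ := exists_approximation_tower k hfin hD X s₀ hX n
  -- The cut serves two purposes: `D⟦s⟧` is `≤ N` for all `s ≥ s₀ + n`, hence has no maps to the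
  -- upper part `R`, and `N ≤ a - 2`, hence `X` has no maps to the lower part `L`.
  obtain ⟨N, hN⟩ : ∃ N : ℤ, N = d - (s₀ + n) := ⟨_, rfl⟩
  obtain ⟨L, R, hL, hR, u, v, w, hT⟩ := t.exists_triangle X₁ N (N + 1) rfl
  replace hL : t.IsLE L N := ⟨hL⟩
  replace hR : t.IsGE R (N + 1) := ⟨hR⟩
  obtain ⟨σ, hσ⟩ : ∃ σ : R ⟶ X₁, σ ≫ v = 𝟙 R := ht.exists_section hT N hL hR
  have hpσ : p ≫ v ≫ σ = p := by
    obtain ⟨x, hx⟩ := exists_lift₂ hT (p - p ≫ v ≫ σ) (by simp [hσ])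
    rw [ht.hom_eq_zero a N (by lia) ha hL x, zero_comp] at hx
    rw [← sub_eq_zero, ← neg_sub, ← hx, neg_zero]
  refine ⟨R, p ≫ v, ?_, ?_, ?_⟩
  · intro s f
    by_cases hs : s < s₀ + n
    · rw [← Category.comp_id f, ← hσ, reassoc_of% (hp₁ s hs (f ≫ σ)), zero_comp]
    · have := t.isLE_shift D d s (d - s)
      exact t.zero f (d - s) (N + 1) (by lia)
  · intro Y hY
    constructor
    · intro g₁ g₂ h
      simp only [Category.assoc] at h
      rw [← Category.id_comp g₁, ← Category.id_comp g₂, ← hσ, Category.assoc, Category.assoc,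
        (hp₂ Y hY).1 h]
    · intro g
      obtain ⟨g₁, rfl⟩ := (hp₂ Y hY).2 g
      exact ⟨σ ≫ g₁, by simp [reassoc_of% hpσ]⟩
  · intro A hA
    refine ⟨fun g => ?_, fun f hf => ?_⟩
    · obtain ⟨g', hg'⟩ := (hp₃ A hA).1 (g ≫ σ)
      exact ⟨g', by rw [reassoc_of% hg', hσ, Category.comp_id]⟩
    · refine (hp₃ A hA).2 f ?_
      rw [← hpσ, reassoc_of% hf, zero_comp]

lemma IsBoundedHereditary.exists_bound (ht : IsBoundedHereditary t) (D X : C) :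
    ∃ s₀ : ℤ, ∀ s < s₀, ∀ f : D⟦s⟧ ⟶ X, f = 0 := by
  obtain ⟨c, hc⟩ := ht.exists_isGE D
  obtain ⟨b, hb⟩ := ht.exists_isLE X
  refine ⟨c - b - 1, fun s hs f => ?_⟩
  exact ht.hom_eq_zero (c - s) b (by lia) (t.isGE_shift D c s (c - s)) hb f

/-- The idempotent `e` splits. -/
def IsSplitIdempotent {X : C} (e : X ⟶ X) : Prop :=
  ∃ (Y : C) (i : Y ⟶ X) (r : X ⟶ Y), i ≫ r = 𝟙 Y ∧ r ≫ i = e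

lemma isSplitIdempotent_of_iso {X X' : C} (α : X ≅ X') (e : X ⟶ X)
    (h : IsSplitIdempotent (α.inv ≫ e ≫ α.hom)) : IsSplitIdempotent e := by
  obtain ⟨Y, i, r, h1, h2⟩ := h
  refine ⟨Y, i ≫ α.inv, α.hom ≫ r, by simp [h1], ?_⟩
  rw [Category.assoc, reassoc_of% h2]
  simp

/-- An idempotent splits if its difference with some split idempotent has square zero. -/
lemma isSplitIdempotent_of_sub {X : C} (e f : X ⟶ X) (he : e ≫ e = e) (hf : IsSplitIdempotent f)
    (hef : (e - f) ≫ (e - f) = 0) : IsSplitIdempotent e := by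
  have hf' : f ≫ f = f := by
    obtain ⟨Y, i, r, h1, rfl⟩ := hf
    simp [reassoc_of% h1]
  -- Multiplying this relation by `f`, respectively `e`, on both sides gives `fef = f` and `efe =
  -- e`, so `e` splits through the object that splits `f`.
  have hef' : e ≫ f + f ≫ e = e + f := by
    simp only [Preadditive.sub_comp, Preadditive.comp_sub, he, hf'] at hef
    rw [← sub_eq_zero, ← neg_eq_zero, ← hef]
    abel
  have hfef : f ≫ e ≫ f = f := by
    have := f ≫= (hef' =≫ f)
    simpa [hf', reassoc_of% hf'] using this
  have hefe : e ≫ f ≫ e = e := by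
    have := e ≫= (hef' =≫ e)
    simpa [he, reassoc_of% he] using this
  obtain ⟨Y, i, r, h1, rfl⟩ := hf
  refine ⟨Y, i ≫ e, e ≫ r, ?_, ?_⟩
  · have := i ≫= (hfef =≫ r)
    simpa [h1, reassoc_of% h1, reassoc_of% he] using this
  · simpa using hefe

/-- Relative to a split truncation triangle `e` is triangular, because no nonzero map goes from the
lower to the upper part. Its diagonal entries are idempotents, split by induction, and `e` differs
from its diagonal by a strictly triangular map, which has square zero. -/
lemma IsBoundedHereditary.isSplitIdempotent (ht : IsBoundedHereditary t)
    (h₀ : ∀ (n : ℤ) (X : C), t.IsGE X n → t.IsLE X n →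
      ∀ e : X ⟶ X, e ≫ e = e → IsSplitIdempotent e)
    (X : C) (e : X ⟶ X) (he : e ≫ e = e) : IsSplitIdempotent e := by
  refine tStructure_induction (t := t)
    (P := fun X => ∀ e : X ⟶ X, e ≫ e = e → IsSplitIdempotent e) h₀ ?_ X (ht.bounded X) e he
  rintro n T hT h₁ h₃ - - hP₁ hP₃ e he
  obtain ⟨σ, ρ, hσ, hρ, hid, hσρ⟩ := ht.exists_splitting hT n h₁ h₃
  have huv : T.mor₁ ≫ T.mor₂ = 0 := comp_distTriang_mor_zero₁₂ _ hT
  generalize T.mor₁ = u at *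
  generalize T.mor₂ = v at *
  have huev : u ≫ e ≫ v = 0 := t.zero _ n (n + 1)
  have hue : u ≫ e = u ≫ e ≫ ρ ≫ u := by
    have := (u ≫ e) ≫= hid
    simpa [reassoc_of% huev] using this.symm
  have hev : e ≫ v = v ≫ σ ≫ e ≫ v := by
    have := hid =≫ (e ≫ v)
    simpa [huev] using this.symm
  obtain ⟨Y₁, i₁, r₁, h11, h12⟩ := hP₁ (u ≫ e ≫ ρ) (by
    simp only [Category.assoc]
    rw [← reassoc_of% hue, reassoc_of% he])
  obtain ⟨Y₃, i₃, r₃, h31, h32⟩ := hP₃ (σ ≫ e ≫ v) (by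
    simp only [Category.assoc]
    rw [← hev, reassoc_of% he])
  refine isSplitIdempotent_of_sub e (ρ ≫ (u ≫ e ≫ ρ) ≫ u + v ≫ (σ ≫ e ≫ v) ≫ σ) he ?_ ?_
  · refine ⟨Y₁ ⊞ Y₃, biprod.desc (i₁ ≫ u) (i₃ ≫ σ), biprod.lift (ρ ≫ r₁) (v ≫ r₃), ?_, ?_⟩
    · ext <;> simp [reassoc_of% hρ, reassoc_of% hσ, reassoc_of% huv, reassoc_of% hσρ, h11, h31]
    · rw [biprod.lift_desc, ← h12, ← h32]
      simp
  · have hn : e - (ρ ≫ (u ≫ e ≫ ρ) ≫ u + v ≫ (σ ≫ e ≫ v) ≫ σ) = v ≫ (σ ≫ e ≫ ρ) ≫ u := by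
      have : e = (ρ ≫ u + v ≫ σ) ≫ e ≫ (ρ ≫ u + v ≫ σ) := by simp [hid]
      nth_rw 1 [this]
      simp only [Preadditive.add_comp, Preadditive.comp_add, Category.assoc, reassoc_of% huev,
        zero_comp, comp_zero]
      abel
    rw [hn]
    simp [reassoc_of% huv]

end

end Reflection

/-! ### Local endomorphism rings of indecomposable objects -/

section Local

/-- In a finite-dimensional algebra without nontrivial idempotents, either `a` or `1 - a`
is a unit. -/
lemma isUnit_or_isUnit_one_sub {k R : Type*} [Field k] [Ring R] [Algebra k R] [Module.Finite k R]
    (h : ∀ x : R, x * x = x → x = 0 ∨ x = 1) (a : R) : IsUnit a ∨ IsUnit (1 - a) := by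
  let S := Algebra.adjoin k {a}
  have : IsMulCommutative S := Algebra.isMulCommutative_adjoin k (by simp)
  let α : S := ⟨a, Algebra.self_mem_adjoin_singleton k a⟩
  have : Module.Finite k S := Module.Finite.of_injective S.val.toLinearMap Subtype.val_injective
  have : IsArtinianRing S := IsArtinianRing.of_finite k S
  -- Fitting's argument in the commutative Artinian ring `k[a]`: once `α ^ (n + 1) * y = α ^ n`, the
  -- element `α ^ n * y ^ n` is idempotent. If it is `0` then `α` is nilpotent; if it is `1` then
  -- `α` is invertible.
  obtain ⟨n, y, hy⟩ := IsArtinian.exists_pow_succ_smul_dvd α (1 : S)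
  simp only [Nat.succ_eq_add_one, smul_eq_mul, mul_one] at hy
  have h₁ : ∀ m, α ^ (n + m) * y ^ m = α ^ n := by
    intro m
    induction m with
    | zero => simp
    | succ m ih =>
      calc α ^ (n + (m + 1)) * y ^ (m + 1) = (α ^ (n + 1) * y) * α ^ m * y ^ m := by ring
        _ = α ^ n := by rw [hy, ← pow_add, ih]
  have h₂ : (α ^ n * y ^ n) * (α ^ n * y ^ n) = α ^ n * y ^ n := by
    calc _ = (α ^ (n + n) * y ^ n) * y ^ n := by ring
      _ = _ := by rw [h₁]
  have hmap : ∀ x : S, IsUnit x → IsUnit (x : R) := fun x hx => hx.map S.val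
  obtain h₃ | h₃ := h (α ^ n * y ^ n : S) (by exact_mod_cast congrArg Subtype.val h₂)
  · right
    have h₄ : α ^ n * y ^ n = 0 := Subtype.ext h₃
    have h₅ : IsNilpotent α := ⟨n, by
      rw [← h₁ n, pow_add, mul_assoc, h₄, mul_zero]⟩
    exact hmap (1 - α) h₅.isUnit_one_sub
  · left
    have h₄ : α ^ n * y ^ n = 1 := Subtype.ext h₃
    have h₅ : α * y = 1 := by
      calc α * y = (α ^ (n + 1) * y) * y ^ n := by rw [← mul_one (α * y), ← h₄]; ring
        _ = 1 := by rw [hy, h₄]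
    exact hmap α (IsUnit.of_mul_eq_one _ h₅)

variable {C : Type u} [Category.{v} C] [Preadditive C] [HasBinaryBiproducts C]

/-- The endomorphism ring of an indecomposable object is local. -/
lemma Indecomposable.isIso_or_isIso_one_sub (k : Type*) [Field k] [Linear k C] {X : C}
    (hX : Indecomposable X)
    (hfin : Module.Finite k (X ⟶ X)) (hsplit : ∀ e : X ⟶ X, e ≫ e = e →
      ∃ (Y : C) (i : Y ⟶ X) (r : X ⟶ Y), i ≫ r = 𝟙 Y ∧ r ≫ i = e)
    (g : X ⟶ X) : IsIso g ∨ IsIso (𝟙 X - g) := by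
  have : Module.Finite k (End X) := hfin
  have key : ∀ e : X ⟶ X, e ≫ e = e → e = 0 ∨ e = 𝟙 X := by
    intro e he
    obtain ⟨Y, i, r, h1, h2⟩ := hsplit e he
    obtain ⟨Z, j, s, h3, h4⟩ := hsplit (𝟙 X - e) (by simp [he])
    have hi : i ≫ e = i := by rw [← h2, reassoc_of% h1]
    have hj : j ≫ (𝟙 X - e) = j := by rw [← h4, reassoc_of% h3]
    have his : i ≫ s = 0 := by
      rw [← Category.comp_id s, ← h3, reassoc_of% h4]
      simp [reassoc_of% hi]
    have hjr : j ≫ r = 0 := by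
      rw [← Category.comp_id r, ← h1, reassoc_of% h2, ← hj]
      simp [reassoc_of% he]
    let α : X ≅ Y ⊞ Z :=
      { hom := biprod.lift r s
        inv := biprod.desc i j
        hom_inv_id := by rw [biprod.lift_desc, h2, h4]; simp
        inv_hom_id := by ext <;> simp [h1, h3, his, hjr] }
    obtain hY | hZ := hX.2 Y Z α
    · left
      rw [← h2, hY.eq_of_src i 0, comp_zero]
    · right
      rw [hZ.eq_of_src j 0, comp_zero] at h4
      exact (sub_eq_zero.1 h4.symm).symm
  obtain h | h := isUnit_or_isUnit_one_sub (k := k) (R := End X) key g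
  · exact Or.inl ((isUnit_iff_isIso g).1 h)
  · exact Or.inr ((isUnit_iff_isIso (X := X) _).1 h)

end Local

/-! ### Discarding zero summands -/

section Basic

variable {C : Type u} [Category.{v} C] [Preadditive C] [HasFiniteBiproducts C]

/-- A finite direct sum is isomorphic to the sum of its nonzero summands. -/
lemma exists_biproduct_iso_of_isZero {n : ℕ} (X : Fin n → C) :
    ∃ (m : ℕ) (φ : Fin m → Fin n), Function.Injective φ ∧ (∀ i, ¬ IsZero (X (φ i))) ∧
      Nonempty (⨁ X ≅ ⨁ (fun i => X (φ i))) := by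
  classical
  let J := {i // ¬ IsZero (X i)}
  let ε : Fin (Fintype.card J) ≃ J := (Fintype.equivFin J).symm
  refine ⟨_, fun i => (ε i).1, Subtype.val_injective.comp ε.injective, fun i => (ε i).2, ⟨?_⟩⟩
  exact
    { hom := biproduct.lift fun i => biproduct.π X (ε i).1
      inv := biproduct.desc fun i => biproduct.ι X (ε i).1
      hom_inv_id := by
        rw [biproduct.lift_desc, ← biproduct.total]
        have : ∀ i, ¬ ¬ IsZero (X i) → biproduct.π X i ≫ biproduct.ι X i = 0 := fun i hi => by
          rw [(not_not.1 hi).eq_of_src (biproduct.ι X i) 0, comp_zero]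
        rw [ε.sum_comp (fun j : J => biproduct.π X j.1 ≫ biproduct.ι X j.1),
          ← Finset.sum_subtype (Finset.univ.filter fun i => ¬ IsZero (X i)) (by simp)
            (fun i => biproduct.π X i ≫ biproduct.ι X i)]
        exact Finset.sum_filter_of_ne fun i _ h => by_contra fun h' => h (this i h')
      inv_hom_id := by
        apply biproduct.hom_ext'
        intro i
        apply biproduct.hom_ext
        intro j
        by_cases hij : i = j
        · subst hij; simp
        · have : (ε i).1 ≠ (ε j).1 := fun h => hij (ε.injective (Subtype.ext h))
          simp [biproduct.ι_π_ne _ this, biproduct.ι_π_ne _ hij] }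

end Basic

/-! ### The left adjoint given by reflections -/

section Adjunction

universe v' u'

variable {C : Type u} [Category.{v} C] [HasZeroObject C] [HasShift C ℤ] [Preadditive C]
  [∀ n : ℤ, (shiftFunctor C n).Additive] [Pretriangulated C] [IsTriangulated C]
  {C' : Type u'} [Category.{v'} C'] [HasZeroObject C'] [HasShift C' ℤ] [Preadditive C']
  [∀ n : ℤ, (shiftFunctor C' n).Additive] [Pretriangulated C'] [IsTriangulated C']
  {F : C' ⥤ C} [F.Full] [F.Faithful]

/-- A fully faithful functor with reflections onto its essential image has a left adjoint. -/
lemma exists_leftAdjoint {P : ObjectProperty C} (hP : ∀ X, F.essImage X ↔ P X)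
    (h : ∀ X, ∃ (X' : C) (p : X ⟶ X'), P X' ∧
      ∀ Y, P Y → Function.Bijective (fun g : X' ⟶ Y => p ≫ g)) :
    ∃ L : C ⥤ C', Nonempty (L ⊣ F) := by
  have h' : ∀ X, ∃ (X' : C') (p : X ⟶ F.obj X'),
      ∀ Y : C', Function.Bijective (fun g : F.obj X' ⟶ F.obj Y => p ≫ g) := fun X => by
    obtain ⟨X', p, hX', hp⟩ := h X
    obtain ⟨Z, ⟨e⟩⟩ := (hP X').2 hX'
    refine ⟨Z, p ≫ e.inv, fun Y => ?_⟩
    have := (hp (F.obj Y) ((hP _).1 (F.obj_mem_essImage Y))).comp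
      (e.symm.homFromEquiv (Z := F.obj Y)).symm.bijective
    convert this using 2 with g
    simp [Iso.homFromEquiv]
  choose L p hp using h'
  exact ⟨_, ⟨Adjunction.adjunctionOfEquivLeft (F_obj := L)
    (fun X Y => (Functor.FullyFaithful.ofFullyFaithful F).homEquiv.trans
      (Equiv.ofBijective _ (hp X Y))) (by intros; simp [Functor.FullyFaithful.homEquiv])⟩⟩

variable {L : C ⥤ C'} (adj : L ⊣ F)
include adj

lemma homEquiv_injective' {X : C} {Y : C'} {g₁ g₂ : L.obj X ⟶ Y}
    (h : adj.unit.app X ≫ F.map g₁ = adj.unit.app X ≫ F.map g₂) : g₁ = g₂ :=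
  (adj.homEquiv X Y).injective (by simpa [Adjunction.homEquiv_unit] using h)

lemma leftAdjoint_linear (k : Type*) [Field k] [Linear k C] [Linear k C'] [F.Additive]
    [F.Linear k] : L.Linear k where
  map_smul f a := homEquiv_injective' adj (by
    rw [F.map_smul, Linear.comp_smul]
    refine (adj.unit_naturality _).trans ?_
    rw [Linear.smul_comp]
    exact congrArg (a • ·) (adj.unit_naturality f).symm)

lemma map_surjective_of_lift {A T : C}
    (h : ∀ g : A ⟶ F.obj (L.obj T), ∃ g' : A ⟶ T, g' ≫ adj.unit.app T = g)
    (g : L.obj A ⟶ L.obj T) : ∃ f : A ⟶ T, L.map f = g := by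
  obtain ⟨f, hf⟩ := h (adj.unit.app A ≫ F.map g)
  exact ⟨f, homEquiv_injective' adj (by rw [← hf, ← Adjunction.unit_naturality])⟩

/-- The unit of the adjunction inherits the properties of any given reflection. -/
lemma exists_iso_of_reflection {P : ObjectProperty C} (hP : ∀ X, F.essImage X ↔ P X)
    {X X' : C} (p : X ⟶ X') (hX' : P X')
    (hp : ∀ Y, P Y → Function.Bijective (fun g : X' ⟶ Y => p ≫ g)) :
    ∃ (c : X' ⟶ F.obj (L.obj X)) (d : F.obj (L.obj X) ⟶ X'), d ≫ c = 𝟙 _ ∧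
      p ≫ c = adj.unit.app X ∧ adj.unit.app X ≫ d = p := by
  obtain ⟨Z, ⟨ε⟩⟩ := (hP X').2 hX'
  obtain ⟨c, hc : p ≫ c = _⟩ :=
    (hp _ ((hP _).1 (F.obj_mem_essImage (L.obj X)))).2 (adj.unit.app X)
  obtain ⟨d', hd'⟩ := (adj.homEquiv X Z).surjective (p ≫ ε.inv)
  rw [Adjunction.homEquiv_unit] at hd'
  refine ⟨c, F.map d' ≫ ε.hom, ?_, hc, by rw [reassoc_of% hd']; simp⟩
  obtain ⟨m, hm⟩ := F.map_surjective ((F.map d' ≫ ε.hom) ≫ c)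
  rw [← hm, ← F.map_id]
  congr 1
  apply homEquiv_injective' adj
  rw [hm, Category.assoc, reassoc_of% hd']
  simp [hc]

end Adjunction

/-! ### Recognizing the quotient algebra -/

section Algebra

variable {k A B : Type*} [Field k] [Ring A] [Algebra k A] [Ring B] [Algebra k B]

/-- A surjective algebra homomorphism with kernel `AeA` induces an isomorphism from `A / AeA`. -/
lemma nonempty_idemQuotient_algEquiv (e : A) (f : A →ₐ[k] B) (hf : Function.Surjective f)
    (he : f e = 0) (hker : ∀ a, f a = 0 → a ∈ TwoSidedIdeal.span {e}) :
    Nonempty (IdemQuotient e ≃ₐ[k] B) := by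
  have hle : TwoSidedIdeal.span {e} ≤ TwoSidedIdeal.ker f := by
    rw [TwoSidedIdeal.span_le]
    rintro _ rfl
    exact (TwoSidedIdeal.mem_ker f).2 he
  let c := (TwoSidedIdeal.span {e}).ringCon
  let g : IdemQuotient e →+* B := c.lift (f : A →+* B) (by
    intro x y hxy
    have := hle ((TwoSidedIdeal.rel_iff _ _ _).1 hxy)
    rw [TwoSidedIdeal.mem_ker, map_sub, sub_eq_zero] at this
    exact this)
  have hg : ∀ a : A, g (a : c.Quotient) = f a := fun a => rfl
  let g' : IdemQuotient e →ₐ[k] B :=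
    { g with commutes' := fun r => (hg _).trans (f.commutes r) }
  refine ⟨AlgEquiv.ofBijective g' ⟨?_, ?_⟩⟩
  · rw [injective_iff_map_eq_zero]
    intro x hx
    obtain ⟨a, rfl⟩ := c.mk'_surjective x
    exact (RingCon.eq c).2 ((TwoSidedIdeal.mem_iff _ _).1 (hker a hx))
  · intro b
    obtain ⟨a, rfl⟩ := hf b
    exact ⟨(a : c.Quotient), rfl⟩

end Algebra

/-! ### Silting reduction along a direct summand -/

section Quotient

universe v' u'

variable {C : Type u} [Category.{v} C] [HasZeroObject C] [HasShift C ℤ] [Preadditive C]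
  [∀ n : ℤ, (shiftFunctor C n).Additive] [Pretriangulated C] [IsTriangulated C]
  {C' : Type u'} [Category.{v'} C'] [HasZeroObject C'] [HasShift C' ℤ] [Preadditive C']
  [∀ n : ℤ, (shiftFunctor C' n).Additive] [Pretriangulated C'] [IsTriangulated C']

/-- The preimage under `L` of a thick subcategory is thick; as it contains `T`, it is everything,
and essential surjectivity concludes. -/
lemma triangEnvelope_obj_eq_top (L : C ⥤ C') [L.CommShift ℤ] [L.IsTriangulated] [L.EssSurj]
    {T : C} (hT : (ObjectProperty.singleton T).triangEnvelope = ⊤) :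
    (ObjectProperty.singleton (L.obj T)).triangEnvelope = ⊤ := by
  let Q := (ObjectProperty.singleton (L.obj T)).triangEnvelope
  have : (Q.inverseImage L).IsStableUnderRetracts :=
    ⟨fun r h => Q.prop_of_retract (r.map L) h⟩
  have hQ : (ObjectProperty.singleton T).triangEnvelope ≤ Q.inverseImage L := by
    rw [ObjectProperty.triangEnvelope_le_iff]
    rintro _ ⟨⟩
    exact ObjectProperty.le_triangEnvelope _ _ (by simp)
  rw [eq_top_iff]
  intro Y _
  have := hQ (L.objPreimage Y) (by rw [hT]; trivial)
  exact Q.prop_of_iso (L.objObjPreimageIso Y) this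

lemma IsSumThrough.of_iso {Z Z' X Y : C} (α : Z ≅ Z') {f : X ⟶ Y} (h : IsSumThrough Z f) :
    IsSumThrough Z' f := by
  obtain ⟨n, a, b, rfl⟩ := h
  exact ⟨n, fun i => a i ≫ α.hom, fun i => α.inv ≫ b i, by simp⟩

lemma IsPresilting.hom_retract_eq_zero {T D : C} (hT : IsPresilting T) (i : D ⟶ T) (r : T ⟶ D)
    (hir : i ≫ r = 𝟙 D) {X Y : C} (hX : X = D ∨ X = T) (hY : Y = D ∨ Y = T) (n : ℤ) (hn : 0 < n)
    (f : X ⟶ Y⟦n⟧) : f = 0 := by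
  have key : ∀ {X Y : C} (a : X ⟶ T) (b : T ⟶ X) (c : Y ⟶ T) (d : T ⟶ Y), a ≫ b = 𝟙 X →
      c ≫ d = 𝟙 Y → ∀ f : X ⟶ Y⟦n⟧, f = 0 := by
    intro X Y a b c d hab hcd f
    have h := hT n hn (b ≫ f ≫ c⟦n⟧')
    calc f = a ≫ (b ≫ f ≫ c⟦n⟧') ≫ d⟦n⟧' := by
          simp [reassoc_of% hab, ← Functor.map_comp, hcd]
      _ = 0 := by rw [h]; simp
  obtain rfl | rfl := hX <;> obtain rfl | rfl := hY
  · exact key i r i r hir hir f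
  · exact key i r (𝟙 _) (𝟙 _) hir (by simp) f
  · exact key (𝟙 _) (𝟙 _) i r (by simp) hir f
  · exact hT n hn f

/-- Images of pairwise non-isomorphic indecomposable objects under a functor `L` that is full on
them are, as long as they are nonzero, indecomposable and pairwise non-isomorphic. -/
lemma IsBasic.map (k : Type*) [Field k] [Linear k C]
    (hfin : ∀ X Y : C, Module.Finite k (X ⟶ Y))
    (hsplit : ∀ (X : C) (e : X ⟶ X), e ≫ e = e → IsSplitIdempotent e)
    (L : C ⥤ C') [L.Additive] {T : C} (hL : ∀ g : L.obj T ⟶ L.obj T, ∃ f, L.map f = g)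
    (hT : IsBasic T) : IsBasic (L.obj T) := by
  obtain ⟨n, X, hX, hne, ⟨α⟩⟩ := hT
  have hloc : ∀ i (g : X i ⟶ X i), IsIso g ∨ IsIso (𝟙 _ - g) := fun i =>
    Indecomposable.isIso_or_isIso_one_sub k (hX i) (hfin _ _) (hsplit _)
  have hfull : ∀ i j (g : L.obj (X i) ⟶ L.obj (X j)), ∃ f, L.map f = g := by
    intro i j g
    obtain ⟨a, b, hab⟩ : ∃ (a : X i ⟶ T) (b : T ⟶ X i), a ≫ b = 𝟙 _ :=
      ⟨biproduct.ι X i ≫ α.inv, α.hom ≫ biproduct.π X i, by simp⟩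
    obtain ⟨c, d, hcd⟩ : ∃ (c : X j ⟶ T) (d : T ⟶ X j), c ≫ d = 𝟙 _ :=
      ⟨biproduct.ι X j ≫ α.inv, α.hom ≫ biproduct.π X j, by simp⟩
    obtain ⟨f, hf⟩ := hL (L.map b ≫ g ≫ L.map c)
    refine ⟨a ≫ f ≫ d, ?_⟩
    rw [L.map_comp, L.map_comp, hf, Category.assoc, Category.assoc, ← L.map_comp, hcd,
      ← L.map_comp_assoc, hab]
    simp
  -- By locality the alternative is that `𝟙 - g` is invertible; but `L` sends it to zero, which
  -- would force `L.obj (X i)` to be zero.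
  have hiso : ∀ i (_ : ¬ IsZero (L.obj (X i))) (g : X i ⟶ X i), L.map g = 𝟙 _ → IsIso g := by
    intro i hi g hg
    refine (hloc i g).resolve_right fun h => hi ?_
    rw [IsZero.iff_id_eq_zero, ← cancel_epi (L.map (𝟙 _ - g)), comp_zero, Category.comp_id,
      L.map_sub, hg]
    simp
  obtain ⟨m, φ, hφ, hnz, ⟨β⟩⟩ := exists_biproduct_iso_of_isZero (fun i => L.obj (X i))
  refine ⟨m, fun i => L.obj (X (φ i)), fun i => ⟨hnz i, ?_⟩, ?_,
    ⟨L.mapIso α ≪≫ L.mapBiproduct X ≪≫ β⟩⟩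
  · intro Y Z γ
    -- The projection onto `Y` lifts to an endomorphism of an indecomposable. By locality the
    -- projection or its complement is invertible, so `Z` or `Y` vanishes.
    obtain ⟨f, hf⟩ := hfull (φ i) (φ i) (γ.hom ≫ biprod.fst ≫ biprod.inl ≫ γ.inv)
    obtain h | h := hloc (φ i) f
    · right
      have h1 : IsIso (γ.hom ≫ biprod.fst ≫ biprod.inl ≫ γ.inv) := by rw [← hf]; infer_instance
      rw [IsZero.iff_id_eq_zero]
      have : biprod.inr ≫ γ.inv = 0 := by
        rw [← cancel_mono (γ.hom ≫ biprod.fst ≫ biprod.inl ≫ γ.inv)]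
        simp
      rw [← biprod.inr_snd (X := Y), ← Category.id_comp (biprod.snd : Y ⊞ Z ⟶ Z),
        ← γ.inv_hom_id, Category.assoc, reassoc_of% this, zero_comp]
    · left
      have h1 : IsIso (𝟙 _ - γ.hom ≫ biprod.fst ≫ biprod.inl ≫ γ.inv) := by
        rw [← hf, ← L.map_id, ← L.map_sub]; infer_instance
      rw [IsZero.iff_id_eq_zero]
      have : biprod.inl ≫ γ.inv = 0 := by
        rw [← cancel_mono (𝟙 _ - γ.hom ≫ biprod.fst ≫ biprod.inl ≫ γ.inv)]
        simp
      rw [← biprod.inl_fst (Y := Z), ← Category.id_comp (biprod.fst : Y ⊞ Z ⟶ Y),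
        ← γ.inv_hom_id, Category.assoc, reassoc_of% this, zero_comp]
  · intro i j hij
    refine ⟨fun γ => ?_⟩
    obtain ⟨f, hf⟩ := hfull _ _ γ.hom
    obtain ⟨g, hg⟩ := hfull _ _ γ.inv
    have h1 : IsIso (f ≫ g) := hiso _ (hnz i) _ (by simp [hf, hg])
    have h2 : IsIso (g ≫ f) := hiso _ (hnz j) _ (by simp [hf, hg])
    have : IsSplitMono f := ⟨⟨g ≫ inv (f ≫ g), by rw [← Category.assoc, IsIso.hom_inv_id]⟩⟩
    have : Epi f := epi_of_epi g f
    have : IsIso f := isIso_of_epi_of_isSplitMono f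
    exact (hne (φ i) (φ j) (hφ.ne hij)).false (asIso f)

variable {F : C' ⥤ C} [F.Full] [F.Faithful] [F.CommShift ℤ] [F.IsTriangulated]
  {t : TStructure C}

/-- The reduction of a silting object `T` along a direct summand `D`, for a category `C'` embedded
in `C` as the subcategory of objects orthogonal to all shifts of `D`. -/
theorem exists_silting_reduction (ht : IsBoundedHereditary t) (k : Type*) [Field k] [Linear k C]
    [Linear k C'] [F.Linear k] (hfin : ∀ X Y : C, Module.Finite k (X ⟶ Y))
    (hsplit : ∀ (X : C) (e : X ⟶ X), e ≫ e = e → IsSplitIdempotent e)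
    {A : Type*} [Ring A] [Algebra k A] (e : A) {T D : C} (hT : IsSilting T)
    (φ : A ≃ₐ[k] End T) (i : D ⟶ T) (r : T ⟶ D) (hir : i ≫ r = 𝟙 D) (hri : r ≫ i = φ e)
    (hF : ∀ X, F.essImage X ↔ shiftPerp D X) :
    ∃ T' : C', IsSilting T' ∧ (IsBasic T → IsBasic T') ∧
      (∀ (Y : C') (n : ℤ), (∀ f : T ⟶ (F.obj Y)⟦n⟧, f = 0) → ∀ f : T' ⟶ Y⟦n⟧, f = 0) ∧
      Nonempty (IdemQuotient e ≃ₐ[k] End T') := by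
  have hDT {X Y : C} := IsPresilting.hom_retract_eq_zero hT.1 i r hir (X := X) (Y := Y)
  have hD : IsPresilting D := hDT (Or.inl rfl) (Or.inl rfl)
  obtain ⟨L, ⟨adj⟩⟩ := exists_leftAdjoint (F := F) hF (fun X => by
    obtain ⟨s₀, hs₀⟩ := ht.exists_bound D X
    obtain ⟨X', p, h1, h2, -⟩ := ht.exists_reflection k hfin hD X s₀ hs₀
    exact ⟨X', p, h1, h2⟩)
  let _ : L.CommShift ℤ := adj.leftAdjointCommShift ℤ
  have : adj.CommShift ℤ := adj.commShift_of_rightAdjoint ℤ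
  have : L.IsTriangulated := adj.isTriangulated_leftAdjoint
  have : L.Linear k := leftAdjoint_linear adj k
  have hLF : ∀ Y : C', IsIso (adj.counit.app Y) := inferInstance
  have : L.EssSurj := ⟨fun Y => ⟨F.obj Y, ⟨asIso (adj.counit.app Y)⟩⟩⟩
  -- The tower may start at `s₀ = 0`, since negative shifts of `D` have no maps to `T`. This is what
  -- makes the kernel consist of maps through `D` itself.
  obtain ⟨X', p, hX', hp, hA⟩ := ht.exists_reflection k hfin hD T 0 (fun s hs f =>
    (hom_shift_eq_zero_iff D T s).2 (hDT (Or.inl rfl) (Or.inr rfl) (-s) (by lia)) f)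
  obtain ⟨c, d, hdc, hpc, hd⟩ := exists_iso_of_reflection adj hF p hX' hp
  have hlift : ∀ A : C, (∀ s > (0 : ℤ), ∀ f : A ⟶ D⟦s⟧, f = 0) →
      ∀ g : A ⟶ F.obj (L.obj T), ∃ g' : A ⟶ T, g' ≫ adj.unit.app T = g := by
    intro A h g
    obtain ⟨g', hg'⟩ := (hA A h).1 (g ≫ d)
    exact ⟨g', by rw [← hpc, reassoc_of% hg', hdc, Category.comp_id]⟩
  have hTD : ∀ s > (0 : ℤ), ∀ f : T ⟶ D⟦s⟧, f = 0 := hDT (Or.inr rfl) (Or.inl rfl)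
  have hsurj := map_surjective_of_lift adj (hlift T hTD)
  have hker : ∀ f : T ⟶ T, L.map f = 0 → IsSumThrough D f := by
    intro f hf
    refine IsSumThrough.of_iso ((shiftFunctorZero C ℤ).app D) ((hA T hTD).2 f ?_)
    rw [← hd, ← Category.assoc, ← adj.unit_naturality, hf]
    simp
  refine ⟨L.obj T, ⟨?_, triangEnvelope_obj_eq_top L hT.2⟩, IsBasic.map k hfin hsplit L hsurj,
    ?_, ?_⟩
  · intro n hn
    obtain ⟨s, rfl⟩ : ∃ s : ℤ, n = -s := ⟨-n, by simp⟩
    refine (hom_shift_eq_zero_iff _ _ s).1 fun f => ?_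
    rw [← cancel_epi ((L.commShiftIso s).hom.app T), comp_zero]
    -- Here `s = -n < 0`, so `T⟦s⟧` has no maps to positive shifts of `D`, and the given map lifts
    -- to some `T⟦s⟧ ⟶ T`, which is zero because `T` is presilting.
    obtain ⟨g, hg⟩ := map_surjective_of_lift adj (hlift (T⟦s⟧) fun s' hs' =>
      IsPresilting.hom_shift_eq_zero hTD (by lia)) ((L.commShiftIso s).hom.app T ≫ f)
    rw [← hg, (hom_shift_eq_zero_iff T T s).2 (hT.1 _ hn) g, L.map_zero]
  · intro Y n h f
    apply homEquiv_injective' adj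
    rw [F.map_zero, comp_zero, ← cancel_mono ((F.commShiftIso n).hom.app Y), zero_comp]
    exact h _
  · let Φ : End T →ₐ[k] End (L.obj T) := AlgHom.ofLinearMap (L.mapLinearMap k)
      (L.map_id T) (fun f g => L.map_comp g f)
    refine nonempty_idemQuotient_algEquiv e (Φ.comp φ.toAlgHom) ?_ ?_ ?_
    · intro g
      obtain ⟨f, hf⟩ := hsurj g
      exact ⟨φ.symm f, (congrArg Φ (φ.apply_symm_apply f)).trans hf⟩
    · change L.map (φ e) = 0
      rw [← hri]
      apply homEquiv_injective' adj
      refine (adj.unit_naturality _).trans ?_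
      rw [F.map_zero, comp_zero]
      change (r ≫ i) ≫ adj.unit.app T = 0
      rw [Category.assoc]
      have := (shiftPerp_iff D _).1 ((hF _).1 (F.obj_mem_essImage (L.obj T))) 0
        (i ≫ adj.unit.app T ≫ (shiftFunctorZero C ℤ).inv.app _)
      rw [← Category.assoc, ← cancel_mono ((shiftFunctorZero C ℤ).inv.app _)]
      simp only [Category.assoc]
      rw [this]
      simp
    · intro a ha
      obtain ⟨n, x, y, hxy⟩ := hker (φ a) ha
      -- Since `i ≫ r = 𝟙 D`, one has `x ≫ y = (x ≫ i) ≫ (r ≫ i) ≫ (r ≫ y)`; multiplication in `End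
      -- T` reverses the order of composition.
      have : a = ∑ j, φ.symm (r ≫ y j) * e * φ.symm (x j ≫ i) := by
        apply φ.injective
        simp only [map_sum, map_mul, AlgEquiv.apply_symm_apply]
        rw [hxy]
        refine Finset.sum_congr rfl fun j _ => ?_
        rw [← hri]
        change _ = (x j ≫ i) ≫ (r ≫ i) ≫ r ≫ y j
        simp [reassoc_of% hir]
      rw [this]
      exact sum_mem fun j _ => TwoSidedIdeal.mul_mem_right _ _ _
        (TwoSidedIdeal.mul_mem_left _ _ _ (TwoSidedIdeal.subset_span rfl))

end Quotient

/-! ### Effaceability of positive Ext classes and dimension shifting -/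

section Effaceable

universe w
variable {H : Type u} [Category.{v} H] [Abelian H]

/-- Represent `f` by a roof `M ← K → N` with `K` in nonpositive degrees. The degree-zero term of `K`
surjects onto `M`, and its chain map to `N`, placed in degree `m ≠ 0`, is zero. -/
lemma exists_epi_comp_Q_hom_eq_zero {M N : H} {m : ℤ} (hm : m < 0)
    (f : DerivedCategory.Q.obj ((CochainComplex.singleFunctor H 0).obj M) ⟶
      DerivedCategory.Q.obj ((CochainComplex.singleFunctor H m).obj N)) :
    ∃ (Z : H) (p : Z ⟶ M), Epi p ∧
      DerivedCategory.Q.map ((CochainComplex.singleFunctor H 0).map p) ≫ f = 0 := by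
  obtain ⟨K, hK, s, hs, g, rfl⟩ := DerivedCategory.right_fac_of_isStrictlyLE f 0
  let j : (CochainComplex.singleFunctor H 0).obj (K.X 0) ⟶ K :=
    HomologicalComplex.mkHomFromSingle (𝟙 _) (fun i _ =>
      (K.isZero_of_isStrictlyLE 0 i (by simp_all; lia)).eq_of_tgt _ _)
  have hj : IsIso (j.f 0) := by
    rw [show j.f 0 = _ from HomologicalComplex.mkHomFromSingle_f _ _, Category.comp_id]
    exact inferInstanceAs (IsIso (HomologicalComplex.singleObjXSelf _ _ _).hom)
  obtain ⟨p, hp⟩ := (CochainComplex.singleFunctor H 0).map_surjective (j ≫ s)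
  have hjg : j ≫ g = 0 := by
    apply HomologicalComplex.from_single_hom_ext
    exact (HomologicalComplex.isZero_single_obj_X (ComplexShape.up ℤ) m N 0 (by lia)).eq_of_tgt _ _
  refine ⟨K.X 0, p, ?_, ?_⟩
  · rw [Preadditive.epi_iff_cancel_zero]
    intro A h hph
    have hsh : s ≫ (CochainComplex.singleFunctor H 0).map h = 0 := by
      apply HomologicalComplex.to_single_hom_ext
      have := (CochainComplex.singleFunctor H 0).congr_map hph
      rw [Functor.map_comp, hp, Functor.map_zero, Category.assoc] at this
      have := HomologicalComplex.congr_hom this 0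
      rw [HomologicalComplex.comp_f, HomologicalComplex.zero_f] at this
      exact (cancel_epi (j.f 0)).1 (this.trans comp_zero.symm)
    apply (DerivedCategory.singleFunctor H 0).map_injective
    rw [Functor.map_zero]
    change DerivedCategory.Q.map ((CochainComplex.singleFunctor H 0).map h) = 0
    rw [← cancel_epi (DerivedCategory.Q.map s), ← Functor.map_comp, hsh, comp_zero,
      Functor.map_zero]
  · rw [hp, Functor.map_comp, Category.assoc, IsIso.hom_inv_id_assoc, ← Functor.map_comp, hjg,
      Functor.map_zero]

/-- A morphism in the derived category from a complex in degree zero to a complex in negative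
degree becomes zero after precomposition with an epimorphism. -/
lemma exists_epi_comp_hom_eq_zero {M N : H} {m : ℤ} (hm : m < 0)
    (f : (DerivedCategory.singleFunctor H 0).obj M ⟶ (DerivedCategory.singleFunctor H m).obj N) :
    ∃ (Z : H) (p : Z ⟶ M), Epi p ∧ (DerivedCategory.singleFunctor H 0).map p ≫ f = 0 :=
  exists_epi_comp_Q_hom_eq_zero hm f

lemma exists_epi_comp_eq_zero [HasExt.{w} H] {M N : H} {n : ℕ} (hn : 0 < n) (ξ : Ext.{w} M N n) :
    ∃ (Z : H) (p : Z ⟶ M), Epi p ∧ (Ext.mk₀ p).comp ξ (zero_add n) = 0 := by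
  let e := ((DerivedCategory.singleFunctors H).shiftIso (n : ℤ) (-n) 0 (by simp)).app N
  obtain ⟨Z, p, hp, h⟩ := exists_epi_comp_hom_eq_zero (m := -n) (by lia) (ξ.hom ≫ e.hom)
  refine ⟨Z, p, hp, ?_⟩
  ext
  rw [← Ext.singleFunctor_map_comp_hom, Ext.zero_hom]
  rw [← Category.assoc] at h
  exact (cancel_mono e.hom).1 (h.trans zero_comp.symm)

/-- Every class in `Ext (n + 1)` is the Yoneda product of the class of a short exact sequence and
a class in `Ext n`. -/
lemma exists_extClass_comp [HasExt.{w} H] {M N : H} {n m : ℕ} (hm : 1 + n = m)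
    (ξ : Ext.{w} M N m) : ∃ (K Z : H) (i : K ⟶ Z) (p : Z ⟶ M) (w : i ≫ p = 0)
      (hS : (ShortComplex.mk i p w).ShortExact) (η : Ext.{w} K N n), hS.extClass.comp η hm = ξ := by
  obtain ⟨Z, p, hp, h⟩ := exists_epi_comp_eq_zero (by lia) ξ
  have hS : (ShortComplex.mk _ _ (kernel.condition p)).ShortExact :=
    { exact := ShortComplex.exact_kernel p }
  obtain ⟨η, hη⟩ := Ext.contravariant_sequence_exact₃ hS N ξ h hm
  exact ⟨_, _, _, _, _, hS, η, hη⟩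

lemma subsingleton_ext_of_two_le [HasExt.{w} H] (h : ∀ X Y : H, Subsingleton (Ext.{w} X Y 2))
    (X Y : H) (n : ℕ) (hn : 2 ≤ n) : Subsingleton (Ext.{w} X Y n) := by
  induction n, hn using Nat.le_induction generalizing X with
  | base => exact h X Y
  | succ n hn ih =>
    refine subsingleton_of_forall_eq 0 fun ξ => ?_
    obtain ⟨K, Z, i, p, w, hS, η, rfl⟩ := exists_extClass_comp (n := n) (by lia) ξ
    rw [(ih K).elim η 0, Ext.comp_zero]

end Effaceable

/-! ### The bounded derived category of a hereditary category -/

section FiniteHereditary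

open DerivedCategory DerivedCategory.TStructure

variable {H : Type u} [Category.{v} H] [Abelian H]

lemma exists_iso_shift_single (X : DerivedCategory H) (n : ℤ) (_ : X.IsGE n) (_ : X.IsLE n) :
    ∃ M : H, Nonempty (X ≅ ((singleFunctor H 0).obj M)⟦-n⟧) := by
  obtain ⟨M, ⟨e⟩⟩ := exists_iso_singleFunctor_obj_of_isGE_of_isLE X n
  exact ⟨M, ⟨e ≪≫ (((singleFunctors H).shiftIso (-n) n 0 (by simp)).app M).symm⟩⟩

lemma bounded_single (M : H) (n : ℤ) :
    (t : TStructure (DerivedCategory H)).bounded ((singleFunctor H n).obj M) :=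
  ⟨⟨n, inferInstanceAs (((singleFunctor H n).obj M).IsGE n)⟩,
    ⟨n, inferInstanceAs (((singleFunctor H n).obj M).IsLE n)⟩⟩

lemma single_hom_shift_eq_zero_of_neg (M N : H) (m : ℤ) (hm : m < 0)
    (f : (singleFunctor H 0).obj M ⟶ ((singleFunctor H 0).obj N)⟦m⟧) : f = 0 := by
  have := t.isGE_shift ((singleFunctor H 0).obj N) 0 m (-m) 
  exact t.zero f 0 (-m) (by lia)

lemma single_hom_shift_eq_zero_of_two_le
    (h : letI := HasExt.standard H; ∀ X Y : H, Subsingleton (Ext.{max u v} X Y 2))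
    (M N : H) (m : ℤ) (hm : 2 ≤ m)
    (f : (singleFunctor H 0).obj M ⟶ ((singleFunctor H 0).obj N)⟦m⟧) : f = 0 := by
  let := HasExt.standard H
  obtain ⟨n, rfl⟩ : ∃ n : ℕ, m = n := ⟨m.toNat, by lia⟩
  have := subsingleton_ext_of_two_le h M N n (by lia)
  exact (Ext.homEquiv (X := M) (Y := N) (n := n)).symm.injective (Subsingleton.elim _ _)

lemma shift_hom_shift_eq_zero {C : Type*} [Category* C] [Preadditive C] [HasShift C ℤ]
    [∀ n : ℤ, (shiftFunctor C n).Additive] {X Y : C} {a b c : ℤ} (hc : a + c = b)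
    (h : ∀ f : X ⟶ Y⟦c⟧, f = 0) (f : X⟦a⟧ ⟶ Y⟦b⟧) : f = 0 := by
  rw [← cancel_mono ((shiftFunctorAdd' C c a b (by lia)).hom.app Y), zero_comp]
  obtain ⟨g, hg⟩ := (shiftFunctor C a).map_surjective
    (f ≫ (shiftFunctorAdd' C c a b (by lia)).hom.app Y)
  rw [← hg, h g, Functor.map_zero]

/-- Morphisms `X ⟶ Y` in the bounded derived category vanish when `X ≥ a` and `Y ≤ a - 2`. -/
lemma hom_eq_zero_of_isGE_of_isLE
    (h : letI := HasExt.standard H; ∀ X Y : H, Subsingleton (Ext.{max u v} X Y 2))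
    (X Y : DerivedCategory H) (hX : t.bounded X) (hY : t.bounded Y) (a b : ℤ) (hab : b + 2 ≤ a)
    (ha : X.IsGE a) (hb : Y.IsLE b) (f : X ⟶ Y) : f = 0 := by
  have hS := fun M N m hm => single_hom_shift_eq_zero_of_two_le h M N m hm
  clear h
  revert ha f
  refine tStructure_induction (t := t) (fun X => X.IsGE a → ∀ f : X ⟶ Y, f = 0) ?_ ?_ X hX
  · intro n X hn hn' ha f
    by_cases hna : n < a
    · exact (t.isZero X n a hna).eq_of_src _ _
    obtain ⟨M, ⟨α⟩⟩ := exists_iso_shift_single X n hn hn'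
    revert hb f
    refine tStructure_induction (t := t) (fun Y => Y.IsLE b → ∀ f : X ⟶ Y, f = 0) ?_ ?_ Y hY
    · intro m Y hm hm' hb f
      by_cases hmb : b < m
      · exact (t.isZero Y b m hmb).eq_of_tgt _ _
      obtain ⟨N, ⟨β⟩⟩ := exists_iso_shift_single Y m hm hm'
      rw [← cancel_epi α.inv, ← cancel_mono β.hom, comp_zero, zero_comp]
      exact shift_hom_shift_eq_zero (c := n - m) (by lia)
        (hS M N _ (by lia)) _
    · intro n T hT _ _ _ hle h₁ h₃ hb f
      obtain ⟨g, rfl⟩ := T.coyoneda_exact₂ hT f (h₃ (hle b hb).2 _)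
      rw [h₁ (hle b hb).1 g, zero_comp]
  · intro n T hT _ _ hge _ h₁ h₃ ha f
    obtain ⟨g, rfl⟩ := T.yoneda_exact₂ hT f (h₁ (hge a ha).1 _)
    rw [h₃ (hge a ha).2 g, comp_zero]

lemma isBoundedHereditary_bounded
    (h : letI := HasExt.standard H; ∀ X Y : H, Subsingleton (Ext.{max u v} X Y 2)) :
    IsBoundedHereditary ((t : TStructure (DerivedCategory H)).bounded.tStructure t) where
  exists_isGE X := by
    obtain ⟨⟨a, ha⟩, -⟩ := X.property
    exact ⟨a, (ObjectProperty.tStructure_isGE_iff ..).2 ha⟩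
  exists_isLE X := by
    obtain ⟨-, ⟨a, ha⟩⟩ := X.property
    exact ⟨a, (ObjectProperty.tStructure_isLE_iff ..).2 ha⟩
  hom_eq_zero {X Y} a b hab hX hY f := by
    apply t.bounded.ι.map_injective
    rw [Functor.map_zero]
    exact hom_eq_zero_of_isGE_of_isLE h _ _ X.property Y.property a b hab
      ((ObjectProperty.tStructure_isGE_iff ..).1 hX)
      ((ObjectProperty.tStructure_isLE_iff ..).1 hY) _

section Finite

variable {k : Type*} [Field k] [Linear k H]

lemma finite_hom_of_iso {C : Type*} [Category* C] [Preadditive C] [Linear k C] {X X' Y Y' : C}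
    (α : X ≅ X') (β : Y ≅ Y') (h : Module.Finite k (X' ⟶ Y')) : Module.Finite k (X ⟶ Y) :=
  Module.Finite.equiv (Linear.homCongr k α β).symm

lemma finite_of_exact {A B C : Type*} [AddCommGroup A] [AddCommGroup B] [AddCommGroup C]
    [Module k A] [Module k B] [Module k C] (f : A →ₗ[k] B) (g : B →ₗ[k] C)
    (h : ∀ b, g b = 0 → ∃ a, f a = b) (_ : Module.Finite k A) (_ : Module.Finite k C) :
    Module.Finite k B := by
  have hle : LinearMap.ker g ≤ LinearMap.range f := fun b hb => h b hb
  have : Module.Finite k (LinearMap.ker g) := Submodule.finiteDimensional_of_le hle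
  have : Module.Finite k (B ⧸ LinearMap.ker g) := Module.Finite.equiv g.quotKerEquivRange.symm
  exact Module.Finite.of_submodule_quotient (LinearMap.ker g)

lemma IsFiniteHereditary.finite_single_hom (h : IsFiniteHereditary k H) (M N : H) (m : ℤ) :
    Module.Finite k ((singleFunctor H 0).obj M ⟶ ((singleFunctor H 0).obj N)⟦m⟧) := by
  let := HasExt.standard H
  by_cases hm : 0 ≤ m
  · obtain ⟨n, rfl⟩ : ∃ n : ℕ, m = n := ⟨m.toNat, by lia⟩
    have := h.ext_finite M N n
    exact Module.Finite.equiv (Ext.homLinearEquiv (R := k) (X := M) (Y := N) (n := n))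
  · have : Subsingleton ((singleFunctor H 0).obj M ⟶ ((singleFunctor H 0).obj N)⟦m⟧) :=
      subsingleton_of_forall_eq 0 (single_hom_shift_eq_zero_of_neg M N m (by lia))
    infer_instance

lemma IsFiniteHereditary.finite_hom (h : IsFiniteHereditary k H) (X Y : DerivedCategory H)
    (hX : t.bounded X) (hY : t.bounded Y) : Module.Finite k (X ⟶ Y) := by
  refine tStructure_induction (t := t) (fun X => Module.Finite k (X ⟶ Y)) ?_ ?_ X hX
  · intro n X hn hn'
    obtain ⟨M, ⟨α⟩⟩ := exists_iso_shift_single X n hn hn'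
    refine tStructure_induction (t := t) (fun Y => Module.Finite k (X ⟶ Y)) ?_ ?_ Y hY
    · intro m Y hm hm'
      obtain ⟨N, ⟨β⟩⟩ := exists_iso_shift_single Y m hm hm'
      have := h.finite_single_hom M N (n - m)
      let γ := (shiftFunctorAdd' (DerivedCategory H) (n - m) (-n) (-m) (by lia)).app
        ((singleFunctor H 0).obj N)
      refine finite_hom_of_iso α (β ≪≫ γ) ?_
      exact Module.Finite.of_surjective
        ((shiftFunctor (DerivedCategory H) (-n)).mapLinearMap k
          (X := (singleFunctor H 0).obj M) (Y := ((singleFunctor H 0).obj N)⟦n - m⟧))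
        (Functor.map_surjective _)
    · intro n T hT _ _ _ _ h₁ h₃
      refine finite_of_exact (Linear.rightComp k X T.mor₁) (Linear.rightComp k X T.mor₂)
        (fun f hf => ?_) h₁ h₃
      obtain ⟨g, hg⟩ := T.coyoneda_exact₂ hT f hf
      exact ⟨g, hg.symm⟩
  · intro n T hT _ _ _ _ h₁ h₃
    refine finite_of_exact (Linear.leftComp k Y T.mor₂) (Linear.leftComp k Y T.mor₁)
      (fun f hf => ?_) h₃ h₁
    obtain ⟨g, hg⟩ := T.yoneda_exact₂ hT f hf
    exact ⟨g, hg.symm⟩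

lemma IsFiniteHereditary.finite_hom_bounded (h : IsFiniteHereditary k H) (X Y : Bounded H) :
    Module.Finite k (X ⟶ Y) :=
  have : Module.Finite k (Bounded.ι.obj X ⟶ Bounded.ι.obj Y) :=
    h.finite_hom X.obj Y.obj X.property Y.property
  Module.Finite.of_injective (Bounded.ι.mapLinearMap k (X := X) (Y := Y))
    Bounded.ι.map_injective

end Finite

/-- Idempotents split in the bounded derived category of a hereditary category. -/
lemma isSplitIdempotent_bounded
    (h : letI := HasExt.standard H; ∀ X Y : H, Subsingleton (Ext.{max u v} X Y 2))
    (X : Bounded H) (e : X ⟶ X) (he : e ≫ e = e) : IsSplitIdempotent e := by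
  refine (isBoundedHereditary_bounded h).isSplitIdempotent (fun n X hn hn' e he => ?_) X e he
  have : X.obj.IsGE n := (ObjectProperty.tStructure_isGE_iff ..).1 hn
  have : X.obj.IsLE n := (ObjectProperty.tStructure_isLE_iff ..).1 hn'
  obtain ⟨M, ⟨α⟩⟩ := exists_iso_singleFunctor_obj_of_isGE_of_isLE X.obj n
  let F : H ⥤ Bounded H := t.bounded.lift (singleFunctor H n) (fun M => bounded_single M n)
  let α' : X ≅ F.obj M := t.bounded.fullyFaithfulι.preimageIso α
  refine isSplitIdempotent_of_iso α' e ?_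
  obtain ⟨p, hp⟩ := F.map_surjective (α'.inv ≫ e ≫ α'.hom)
  obtain ⟨I, i, r, hi, hr⟩ := IsIdempotentComplete.idempotents_split M p
    (F.map_injective (by simp [hp, reassoc_of% he]))
  exact ⟨F.obj I, F.map i, F.map r, by rw [← Functor.map_comp, hi, CategoryTheory.Functor.map_id],
    by rw [← Functor.map_comp, hr, hp]⟩

end FiniteHereditary

/-! ### Closure properties of the perpendicular category -/

section Perpendicular

open DerivedCategory DerivedCategory.TStructure

variable {H : Type u} [Category.{v} H] [Abelian H] (D : Bounded H)

lemma perpZ_iff (M : H) : perpZ D M ↔ shiftPerp D.obj ((singleFunctor H 0).obj M) :=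
  (shiftPerp_iff _ _).symm

instance : (perpZ D).IsClosedUnderIsomorphisms where
  of_iso e h := (perpZ_iff D _).2
    ((shiftPerp D.obj).prop_of_iso ((singleFunctor H 0).mapIso e) ((perpZ_iff D _).1 h))

instance : (perpZ D).ContainsZero where
  exists_zero := ⟨_, isZero_zero H, (perpZ_iff D _).2 fun _ _ =>
    ((singleFunctor H 0).map_isZero (isZero_zero H)).eq_of_tgt _ _⟩

instance : (perpZ D).IsClosedUnderFiniteProducts where
  isClosedUnderLimitsOfShape J _ := ⟨by
    rintro X ⟨c⟩
    refine (perpZ_iff D X).2 fun s f => ?_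
    refine (isLimitOfPreserves (singleFunctor H 0) c.isLimit).hom_ext fun j => ?_
    exact ((perpZ_iff D _).1 (c.prop_diag_obj j) s _).trans zero_comp.symm⟩

instance : (perpZ D).IsClosedUnderExtensions where
  prop_X₂_of_shortExact hS h₁ h₃ := (perpZ_iff D _).2
    ((shiftPerp D.obj).ext_of_isTriangulatedClosed₂ _ hS.singleTriangle_distinguished
      ((perpZ_iff D _).1 h₁) ((perpZ_iff D _).1 h₃))

variable (h : letI := HasExt.standard H; ∀ X Y : H, Subsingleton (Ext.{max u v} X Y 2))
include h

/-- If `Ext² = 0`, then images of morphisms in the perpendicular category belong to it. -/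
lemma perpZ_of_epi_of_mono {M I N : H} (p : M ⟶ I) [Epi p] (i : I ⟶ N) [Mono i]
    (hM : perpZ D M) (hN : perpZ D N) : perpZ D I := by
  have hS₁ : (ShortComplex.mk _ _ (kernel.condition p)).ShortExact :=
    { exact := ShortComplex.exact_kernel p }
  have hS₂ : (ShortComplex.mk _ _ (cokernel.condition i)).ShortExact :=
    { exact := ShortComplex.exact_cokernel i }
  -- The composite of `(cokernel i)⟦-1⟧ ⟶ I` with the connecting map `I ⟶ (kernel p)⟦1⟧` is an
  -- `Ext²` class, hence zero, so the connecting map factors through `i`. A map from `D⟦s⟧` to `I`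
  -- dies in `N`, therefore lifts to `M`, and so is zero.
  obtain ⟨x, hx⟩ := Triangle.yoneda_exact₂ _
    (inv_rot_of_distTriang _ hS₂.singleTriangle_distinguished) hS₁.singleδ
      (shift_hom_shift_eq_zero (c := 2) (by norm_num)
        (single_hom_shift_eq_zero_of_two_le h _ _ 2 le_rfl) _)
  refine (perpZ_iff D I).2 fun s f => ?_
  have hf : f ≫ (singleFunctor H 0).map i = 0 := (perpZ_iff D N).1 hN s _
  obtain ⟨g, hg⟩ := Triangle.coyoneda_exact₃ _ hS₁.singleTriangle_distinguished f (by
    change f ≫ hS₁.singleδ = 0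
    rw [hx]
    exact (Category.assoc _ _ _).symm.trans ((congrArg (· ≫ x) hf).trans zero_comp))
  exact hg.trans ((congrArg (· ≫ _) ((perpZ_iff D M).1 hM s g)).trans zero_comp)

/-- Once the image is known to be perpendicular, the kernel is the third vertex of a triangle whose
other two lie in the triangulated subcategory `shiftPerp D.obj`. Cokernels are dual. -/
lemma isClosedUnderKernels_perpZ : (perpZ D).IsClosedUnderKernels where
  kernels_le := by
    rintro _ ⟨f, c, hc, hf⟩
    let p := factorThruImage f
    let i := Limits.image.ι f
    have hI := perpZ_of_epi_of_mono D h p i hf.1 hf.2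
    have hS : (ShortComplex.mk _ _ (kernel.condition p)).ShortExact :=
      { exact := ShortComplex.exact_kernel p }
    have hK := (shiftPerp D.obj).ext_of_isTriangulatedClosed₁ _ hS.singleTriangle_distinguished
      ((perpZ_iff D _).1 hf.1) ((perpZ_iff D _).1 hI)
    exact (perpZ D).prop_of_iso ((kernelCompMono p i).symm ≪≫
      kernelIsoOfEq (Limits.image.fac f) ≪≫
      (kernelIsKernel f).conePointUniqueUpToIso hc) ((perpZ_iff D _).2 hK)

lemma isClosedUnderCokernels_perpZ : (perpZ D).IsClosedUnderCokernels where
  cokernels_le := by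
    rintro _ ⟨f, c, hc, hf⟩
    let p := factorThruImage f
    let i := Limits.image.ι f
    have hI := perpZ_of_epi_of_mono D h p i hf.1 hf.2
    have hS : (ShortComplex.mk _ _ (cokernel.condition i)).ShortExact :=
      { exact := ShortComplex.exact_cokernel i }
    have hK := (shiftPerp D.obj).ext_of_isTriangulatedClosed₃ _ hS.singleTriangle_distinguished
      ((perpZ_iff D _).1 hI) ((perpZ_iff D _).1 hf.2)
    exact (perpZ D).prop_of_iso ((cokernelEpiComp p i).symm ≪≫
      cokernelIsoOfEq (Limits.image.fac f) ≪≫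
      (cokernelIsCokernel f).coconePointUniqueUpToIso hc) ((perpZ_iff D _).2 hK)

end Perpendicular

/-! ### Ext groups along a fully faithful exact functor -/

section ExtComparison

universe w w' v' u'

variable {H : Type u} [Category.{v} H] [Abelian H]

lemma shortExact_pushout {K Z M N : H} {i : K ⟶ Z} {p : Z ⟶ M} {w : i ≫ p = 0}
    (hS : (ShortComplex.mk i p w).ShortExact) (g : K ⟶ N) :
    (ShortComplex.mk (pushout.inr i g) (pushout.desc p 0 (w.trans comp_zero.symm))
      (pushout.inr_desc _ _ _)).ShortExact := by
  have : Mono i := hS.mono_f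
  have : Epi p := hS.epi_g
  have h : i ≫ p = g ≫ 0 := w.trans comp_zero.symm
  have : Epi (pushout.desc p 0 h) := epi_of_epi_fac (pushout.inl_desc p 0 h)
  refine { exact := ?_ }
  refine ShortComplex.exact_of_g_is_cokernel _
    (CokernelCofork.IsColimit.ofπ' _ _ fun {A} k hk => ?_)
  have h0 : i ≫ pushout.inl i g ≫ k = 0 := by
    rw [pushout.condition_assoc]
    exact (congrArg _ hk).trans comp_zero
  refine ⟨hS.exact.desc (pushout.inl i g ≫ k) h0, pushout.hom_ext ?_ ?_⟩
  · rw [pushout.inl_desc_assoc]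
    exact hS.exact.g_desc _ _
  · rw [pushout.inr_desc_assoc, zero_comp]
    exact hk.symm

/-- Every class in `Ext¹` is the class of a short exact sequence. -/
lemma exists_extClass_eq [HasExt.{w} H] {M N : H} (ξ : Ext.{w} M N 1) :
    ∃ (E : H) (i : N ⟶ E) (p : E ⟶ M) (w : i ≫ p = 0)
      (hS : (ShortComplex.mk i p w).ShortExact), hS.extClass = ξ := by
  obtain ⟨K, Z, i, p, w, hS, η, rfl⟩ := exists_extClass_comp (n := 0) rfl ξ
  obtain ⟨g, rfl⟩ := (Ext.mk₀_bijective _ _).2 η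
  refine ⟨_, _, _, _, shortExact_pushout hS g, ?_⟩
  have := ShortComplex.ShortExact.extClass_naturality hS (shortExact_pushout hS g)
    { τ₁ := g, τ₂ := pushout.inl i g, τ₃ := 𝟙 M
      comm₁₂ := pushout.condition.symm
      comm₂₃ := (pushout.inl_desc _ _ _).trans (Category.comp_id _).symm }
  exact (this.trans (Ext.mk₀_id_comp _)).symm

variable {W : Type u'} [Category.{v'} W] [Abelian W] (F : W ⥤ H) [F.Additive]
  [PreservesFiniteLimits F] [PreservesFiniteColimits F] [F.Full] [F.Faithful]
  [HasExt.{w} H] [HasExt.{w'} W]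

lemma mapExactFunctor_bijective_zero (M N : W) :
    Function.Bijective (Ext.mapExactFunctor F (X := M) (Y := N) (n := 0) :
      Ext.{w'} M N 0 → Ext.{w} _ _ 0) := by
  rw [Ext.mapExactFunctor₀]
  exact Ext.homEquiv₀.symm.bijective.comp
    (Function.Bijective.comp ⟨F.map_injective, F.map_surjective⟩ Ext.homEquiv₀.bijective)

/-- Dimension shifting: write the class as `δ · η`, with `δ` the class of `K → Z → M`. If its image
vanishes, the image of `η` extends from `F K` to `F Z`; by bijectivity in degree `n`, `η` itself
extends to `Z`, and so `δ · η = 0`. -/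
lemma mapExactFunctor_injective_succ (n : ℕ)
    (hn : ∀ M N : W, Function.Bijective (Ext.mapExactFunctor F (X := M) (Y := N) (n := n) :
      Ext.{w'} M N n → Ext.{w} _ _ n)) (M N : W) :
    Function.Injective (Ext.mapExactFunctor F (X := M) (Y := N) (n := n + 1) :
      Ext.{w'} M N (n + 1) → Ext.{w} _ _ (n + 1)) := by
  refine (injective_iff_map_eq_zero (F.mapExtAddHom M N (n + 1))).2 fun ξ hξ => ?_
  obtain ⟨K, Z, i, p, w, hS, η, rfl⟩ := exists_extClass_comp (add_comm 1 n) ξ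
  rw [Functor.mapExtAddHom_apply, Ext.mapExactFunctor_comp, Ext.mapExactFunctor_extClass] at hξ
  obtain ⟨y, hy⟩ := Ext.contravariant_sequence_exact₁ (hS.map_of_exact F) _ _ _ hξ
  obtain ⟨y, rfl⟩ := (hn Z N).2 y
  obtain rfl : (Ext.mk₀ i).comp y (zero_add n) = η := by
    apply (hn K N).1
    rw [Ext.mapExactFunctor_comp, Ext.mapExactFunctor_mk₀]
    exact hy
  exact hS.extClass_comp_assoc y

/-- An `Ext¹` class is an actual extension, whose middle term lies in the essential image; full
faithfulness lifts the whole sequence to `W`. -/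
lemma mapExactFunctor_surjective_one [F.essImage.IsClosedUnderExtensions] (M N : W) :
    Function.Surjective (Ext.mapExactFunctor F (X := M) (Y := N) (n := 1) :
      Ext.{w'} M N 1 → Ext.{w} _ _ 1) := by
  intro ξ
  obtain ⟨E, i, p, w, hS, rfl⟩ := exists_extClass_eq ξ
  obtain ⟨E', ⟨α : F.obj E' ≅ E⟩⟩ := F.essImage.prop_X₂_of_shortExact hS (F.obj_mem_essImage N)
    (F.obj_mem_essImage M)
  let S : ShortComplex W := ShortComplex.mk (F.preimage (i ≫ α.inv)) (F.preimage (α.hom ≫ p))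
    (F.map_injective (by simp [w]))
  let β : S.map F ≅ ShortComplex.mk i p w :=
    ShortComplex.isoMk (Iso.refl _) α (Iso.refl _)
      ((Category.id_comp i).trans ((by simp : i = (i ≫ α.inv) ≫ α.hom).trans
        (congrArg (· ≫ α.hom) (F.map_preimage _).symm)))
      ((F.map_preimage (α.hom ≫ p)).symm.trans (Category.comp_id _).symm)
  have hSF : (S.map F).ShortExact := ShortComplex.shortExact_of_iso β.symm hS
  have := hSF.mono_f
  have := hSF.epi_g
  have hS' : S.ShortExact :=
    { exact := (ShortComplex.exact_map_iff_of_faithful S F).1 hSF.exact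
      mono_f := F.mono_of_mono_map hSF.mono_f
      epi_g := F.epi_of_epi_map hSF.epi_g }
  refine ⟨hS'.extClass, ?_⟩
  rw [Ext.mapExactFunctor_extClass]
  have := ShortComplex.ShortExact.extClass_naturality (hS'.map_of_exact F) hS β.hom
  exact (Ext.comp_mk₀_id _).symm.trans (this.trans (Ext.mk₀_id_comp _))

end ExtComparison

/-! ### Dévissage for full faithfulness of triangulated functors -/

section HomBijective

universe v' u'

section

variable {C : Type u} [Category.{v} C] {B : Type u'} [Category.{v'} B] (G : C ⥤ B)

/-- The functor `G` induces a bijection on the morphisms from `X` to `Y`. -/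
def IsHomBijective (X Y : C) : Prop :=
  Function.Bijective (G.map : (X ⟶ Y) → (G.obj X ⟶ G.obj Y))

variable {G}

lemma IsHomBijective.of_iso {X X' Y Y' : C} (h : IsHomBijective G X Y) (α : X ≅ X') (β : Y ≅ Y') :
    IsHomBijective G X' Y' := by
  have : (G.map : (X' ⟶ Y') → (G.obj X' ⟶ G.obj Y')) =
      ((G.mapIso α).homCongr (G.mapIso β)) ∘ G.map ∘ (α.homCongr β).symm := by
    ext f
    simp [Iso.homCongr]
  unfold IsHomBijective
  rw [this]
  exact (Equiv.bijective _).comp (Function.Bijective.comp h (Equiv.bijective _))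

lemma IsHomBijective.shift [HasShift C ℤ] [HasShift B ℤ] [G.CommShift ℤ] {X Y : C}
    (h : IsHomBijective G X Y) (n : ℤ) : IsHomBijective G (X⟦n⟧) (Y⟦n⟧) := by
  have hs : Function.Bijective ((shiftFunctor C n).map : (X ⟶ Y) → (X⟦n⟧ ⟶ Y⟦n⟧)) :=
    ⟨(shiftFunctor C n).map_injective, (shiftFunctor C n).map_surjective⟩
  have hs' : Function.Bijective
      ((shiftFunctor B n).map : (G.obj X ⟶ G.obj Y) → ((G.obj X)⟦n⟧ ⟶ (G.obj Y)⟦n⟧)) :=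
    ⟨(shiftFunctor B n).map_injective, (shiftFunctor B n).map_surjective⟩
  refine (Function.Bijective.of_comp_iff _ hs).1 ?_
  have : (G.map : (X⟦n⟧ ⟶ Y⟦n⟧) → _) ∘ (shiftFunctor C n).map =
      (((G.commShiftIso n).app X).homCongr ((G.commShiftIso n).app Y)).symm ∘
        (shiftFunctor B n).map ∘ G.map := by
    ext f
    simp [Iso.homCongr]
  rw [this]
  exact (Equiv.bijective _).comp (hs'.comp h)

end

variable {C : Type u} [Category.{v} C] [HasZeroObject C] [HasShift C ℤ] [Preadditive C]
  [∀ n : ℤ, (shiftFunctor C n).Additive] [Pretriangulated C]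
  {B : Type u'} [Category.{v'} B] [HasZeroObject B] [HasShift B ℤ] [Preadditive B]
  [∀ n : ℤ, (shiftFunctor B n).Additive] [Pretriangulated B]
  {G : C ⥤ B} [G.CommShift ℤ] [G.IsTriangulated]

lemma exists_invRotate {T : Triangle C} (hT : T ∈ distTriang C) :
    ∃ (δ : T.obj₃⟦(-1 : ℤ)⟧ ⟶ T.obj₁) (h : T.obj₂ ⟶ (T.obj₃⟦(-1 : ℤ)⟧)⟦(1 : ℤ)⟧),
      Triangle.mk δ T.mor₁ h ∈ distTriang C :=
  ⟨_, _, inv_rot_of_distTriang _ hT⟩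

lemma exists_map_lift {X Y Z : C} {f : X ⟶ Y} {g : Y ⟶ Z} {h : Z ⟶ X⟦(1 : ℤ)⟧}
    (hT : Triangle.mk f g h ∈ distTriang C) {A : B} (φ : A ⟶ G.obj Y) (hφ : φ ≫ G.map g = 0) :
    ∃ ψ : A ⟶ G.obj X, ψ ≫ G.map f = φ := by
  obtain ⟨ψ, hψ⟩ := Triangle.coyoneda_exact₂ _ (G.map_distinguished _ hT) φ hφ
  exact ⟨ψ, hψ.symm⟩

/-- The five lemma for `Hom(-, Y)`, with the four neighbouring terms of the long exact sequence as
hypotheses. -/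
lemma IsHomBijective.of_distTriang_source {T : Triangle C} (hT : T ∈ distTriang C) {Y : C}
    (h₁ : IsHomBijective G T.obj₁ Y) (h₃ : IsHomBijective G T.obj₃ Y)
    (h₁' : IsHomBijective G (T.obj₁⟦(1 : ℤ)⟧) Y)
    (h₃' : IsHomBijective G (T.obj₃⟦(-1 : ℤ)⟧) Y) : IsHomBijective G T.obj₂ Y := by
  have hGT := G.map_distinguished T hT
  constructor
  · refine (injective_iff_map_eq_zero G.mapAddHom).2 fun φ (hφ : G.map φ = 0) => ?_
    obtain ⟨χ, rfl⟩ := T.yoneda_exact₂ hT φ (h₁.1 (by simp [hφ]))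
    rw [Functor.map_comp] at hφ
    obtain ⟨ω, hω⟩ := Triangle.yoneda_exact₃ _ hGT (G.map χ) hφ
    obtain ⟨ω', hω'⟩ := h₁'.2 ((G.commShiftIso (1 : ℤ)).hom.app _ ≫ ω)
    obtain rfl : χ = T.mor₃ ≫ ω' := by
      apply h₃.1
      rw [Functor.map_comp, hω', hω]
      exact Category.assoc _ _ _
    rw [comp_distTriang_mor_zero₂₃_assoc _ hT, zero_comp]
  · intro φ
    obtain ⟨ψ, hψ⟩ := h₁.2 (G.map T.mor₁ ≫ φ)
    obtain ⟨δ, h, hr⟩ := exists_invRotate hT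
    have hδ : δ ≫ T.mor₁ = 0 := comp_distTriang_mor_zero₁₂ _ hr
    obtain ⟨ψ', rfl⟩ := exists_desc₂ hr ψ (h₃'.1 (by
      rw [Functor.map_comp, hψ, ← Functor.map_comp_assoc, hδ, Functor.map_zero, zero_comp,
        Functor.map_zero]))
    obtain ⟨χ, hχ⟩ := Triangle.yoneda_exact₂ _ hGT (φ - G.map ψ') (by
      have : G.map T.mor₁ ≫ (φ - G.map ψ') = 0 := by
        rw [Preadditive.comp_sub, ← hψ, ← Functor.map_comp, sub_self]
      exact this)
    obtain ⟨χ', rfl⟩ := h₃.2 χ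
    refine ⟨ψ' + T.mor₂ ≫ χ', ?_⟩
    rw [Functor.map_add, Functor.map_comp]
    exact (add_comm _ _).trans (sub_eq_iff_eq_add.1 hχ).symm

lemma IsHomBijective.of_distTriang_target {T : Triangle C} (hT : T ∈ distTriang C) {X : C}
    (h₁ : IsHomBijective G X T.obj₁) (h₃ : IsHomBijective G X T.obj₃)
    (h₁' : IsHomBijective G X (T.obj₁⟦(1 : ℤ)⟧))
    (h₃' : IsHomBijective G X (T.obj₃⟦(-1 : ℤ)⟧)) : IsHomBijective G X T.obj₂ := by
  have hGT := G.map_distinguished T hT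
  constructor
  · refine (injective_iff_map_eq_zero G.mapAddHom).2 fun φ (hφ : G.map φ = 0) => ?_
    obtain ⟨χ, rfl⟩ := T.coyoneda_exact₂ hT φ (h₃.1 (by simp [hφ]))
    obtain ⟨δ, h, hr⟩ := exists_invRotate hT
    have hδ : δ ≫ T.mor₁ = 0 := comp_distTriang_mor_zero₁₂ _ hr
    rw [Functor.map_comp] at hφ
    obtain ⟨ω, hω⟩ := exists_map_lift hr (G.map χ) hφ
    obtain ⟨ω', rfl⟩ := h₃'.2 ω
    obtain rfl : ω' ≫ δ = χ := h₁.1 (by rw [Functor.map_comp, hω])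
    rw [Category.assoc, hδ, comp_zero]
  · intro φ
    obtain ⟨ψ, hψ⟩ := h₃.2 (φ ≫ G.map T.mor₂)
    obtain ⟨ψ', rfl⟩ := T.coyoneda_exact₃ hT ψ (h₁'.1 (by
      rw [Functor.map_comp, hψ, Category.assoc, ← Functor.map_comp,
        comp_distTriang_mor_zero₂₃ _ hT, Functor.map_zero, comp_zero, Functor.map_zero]))
    obtain ⟨χ, hχ⟩ := Triangle.coyoneda_exact₂ _ hGT (φ - G.map ψ') (by
      have : (φ - G.map ψ') ≫ G.map T.mor₂ = 0 := by
        rw [Preadditive.sub_comp, ← hψ, ← Functor.map_comp, sub_self]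
      exact this)
    obtain ⟨χ', rfl⟩ := h₁.2 χ
    refine ⟨ψ' + χ' ≫ T.mor₁, ?_⟩
    rw [Functor.map_add, Functor.map_comp]
    exact (add_comm _ _).trans (sub_eq_iff_eq_add.1 hχ).symm

/-- Dévissage for the bijectivity of a triangulated functor on morphisms. -/
lemma IsHomBijective.of_bounded [IsTriangulated C] {t : TStructure C}
    (h : ∀ (n m : ℤ) (X Y : C), t.IsGE X n → t.IsLE X n → t.IsGE Y m → t.IsLE Y m →
      IsHomBijective G X Y) (X Y : C) (hX : t.bounded X) (hY : t.bounded Y) :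
    IsHomBijective G X Y := by
  have hpure : ∀ (n : ℤ) (X : C), t.IsGE X n → t.IsLE X n → IsHomBijective G X Y := by
    intro n X hn hn'
    -- The claim is strengthened to all shifts because the five lemma uses the vertices shifted by
    -- `1` and `-1`.
    suffices ∀ s : ℤ, IsHomBijective G X (Y⟦s⟧) from
      (this 0).of_iso (Iso.refl _) ((shiftFunctorZero C ℤ).app Y)
    refine tStructure_induction (t := t) (fun Y => ∀ s : ℤ, IsHomBijective G X (Y⟦s⟧))
      ?_ ?_ Y hY
    · intro m Y hm hm' s
      exact h n (m - s) X _ hn hn' (t.isGE_shift Y m s (m - s)) (t.isLE_shift Y m s (m - s))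
    · intro _ T hT _ _ _ _ h₁ h₃ s
      exact .of_distTriang_target (Triangle.shift_distinguished T hT s) (h₁ s) (h₃ s)
        ((h₁ (s + 1)).of_iso (Iso.refl _) ((shiftFunctorAdd C s 1).app _))
        ((h₃ (s + -1)).of_iso (Iso.refl _) ((shiftFunctorAdd C s (-1)).app _))
  suffices ∀ s : ℤ, IsHomBijective G (X⟦s⟧) Y from
    (this 0).of_iso ((shiftFunctorZero C ℤ).app X) (Iso.refl _)
  refine tStructure_induction (t := t) (fun X => ∀ s : ℤ, IsHomBijective G (X⟦s⟧) Y)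
    ?_ ?_ X hX
  · intro m X hm hm' s
    exact hpure (m - s) _ (t.isGE_shift X m s (m - s)) (t.isLE_shift X m s (m - s))
  · intro _ T hT _ _ _ _ h₁ h₃ s
    exact .of_distTriang_source (Triangle.shift_distinguished T hT s) (h₁ s) (h₃ s)
      ((h₁ (s + 1)).of_iso ((shiftFunctorAdd C s 1).app _) (Iso.refl _))
      ((h₃ (s + -1)).of_iso ((shiftFunctorAdd C s (-1)).app _) (Iso.refl _))

lemma shiftPerp_iff_of_fullyFaithful [G.Full] [G.Faithful] (D Y : C) :
    shiftPerp (G.obj D) (G.obj Y) ↔ shiftPerp D Y := by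
  constructor
  · intro h s f
    apply G.map_injective
    rw [← cancel_epi ((G.commShiftIso s).inv.app D), Functor.map_zero, comp_zero]
    exact h s _
  · intro h s f
    obtain ⟨g, hg⟩ := G.map_surjective ((G.commShiftIso s).hom.app D ≫ f)
    rw [← cancel_epi ((G.commShiftIso s).hom.app D), ← hg, h s g, Functor.map_zero, comp_zero]

end HomBijective

/-! ### The derived inclusion and its essential image -/

section DerivedFunctor

open DerivedCategory DerivedCategory.TStructure

variable {H : Type u} [Category.{v} H] [Abelian H] {W : Type u} [Category.{v} W] [Abelian W]
  (F : W ⥤ H) [F.Additive] [PreservesFiniteLimits F] [PreservesFiniteColimits F]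

/-- The derived functor of an exact functor sends an object concentrated in degree `n` to an
object concentrated in degree `n`. -/
noncomputable def mapShiftSingleIso (M : W) (n : ℤ) :
    F.mapDerivedCategory.obj (((singleFunctor W 0).obj M)⟦n⟧) ≅
      ((singleFunctor H 0).obj (F.obj M))⟦n⟧ :=
  (F.mapDerivedCategory.commShiftIso n).app _ ≪≫
    (shiftFunctor _ n).mapIso ((F.mapDerivedCategorySingleFunctor 0).app M)

/-- A triangulated property that holds for the images of the objects of `W` holds for the images
of the bounded complexes. -/
lemma prop_mapDerivedCategory_obj (P : ObjectProperty (DerivedCategory H)) [P.IsTriangulated]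
    [P.IsClosedUnderIsomorphisms] (hP : ∀ M : W, P ((singleFunctor H 0).obj (F.obj M)))
    (X : DerivedCategory W) (hX : t.bounded X) : P (F.mapDerivedCategory.obj X) := by
  refine tStructure_induction (t := t) (fun X => P (F.mapDerivedCategory.obj X)) ?_ ?_ X hX
  · intro n X hn hn'
    obtain ⟨M, ⟨α⟩⟩ := exists_iso_shift_single X n hn hn'
    exact P.prop_of_iso (F.mapDerivedCategory.mapIso α ≪≫ mapShiftSingleIso F M _).symm
      (P.le_shift (-n) _ (hP M))
  · intro _ T hT _ _ _ _ h₁ h₃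
    exact P.ext_of_isTriangulatedClosed₂ _ (F.mapDerivedCategory.map_distinguished T hT) h₁ h₃

/-- The functor between bounded derived categories induced by an exact functor. -/
noncomputable abbrev mapBounded : Bounded W ⥤ Bounded H :=
  t.bounded.lift (Bounded.ι ⋙ F.mapDerivedCategory) fun X =>
    prop_mapDerivedCategory_obj F t.bounded (fun _ => bounded_single _ 0) X.obj X.property

instance (k : Type*) [Field k] [Linear k H] [Linear k W] [F.Linear k] :
    (mapBounded F).Linear k where
  map_smul f r := by
    apply Bounded.ι.map_injective
    exact Functor.Linear.map_smul (F := F.mapDerivedCategory) (Bounded.ι.map f) r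

variable [F.Full] [F.Faithful] [F.essImage.IsClosedUnderExtensions]
  (h : letI := HasExt.standard H; ∀ X Y : H, Subsingleton (Ext.{max u v} X Y 2))
include F h

lemma mapExactFunctor_bijective_of_le_one (M N : W) (n : ℕ) (hn : n ≤ 1) :
    letI := HasExt.standard H
    letI := HasExt.standard W
    Function.Bijective (Ext.mapExactFunctor F (X := M) (Y := N) (n := n) :
      Ext.{max u v} M N n → Ext.{max u v} _ _ n) := by
  let := HasExt.standard H
  let := HasExt.standard W
  obtain rfl | rfl : n = 0 ∨ n = 1 := by clear h; omega
  · exact mapExactFunctor_bijective_zero F M N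
  · exact ⟨mapExactFunctor_injective_succ F 0 (mapExactFunctor_bijective_zero F) M N,
      mapExactFunctor_surjective_one F M N⟩

/-- Bijectivity on `Ext¹` gives injectivity on `Ext²`, so `Ext²` over `W` embeds into a zero group
over `H`. -/
lemma subsingleton_ext_two :
    letI := HasExt.standard W
    ∀ X Y : W, Subsingleton (Ext.{max u v} X Y 2) := by
  let := HasExt.standard H
  let := HasExt.standard W
  intro X Y
  have := h (F.obj X) (F.obj Y)
  exact (mapExactFunctor_injective_succ F 1
    (fun M N => mapExactFunctor_bijective_of_le_one F h M N 1 le_rfl) X Y).subsingleton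

lemma IsFiniteHereditary.of_fullyFaithful {k : Type*} [Field k] [Linear k H] [Linear k W]
    [F.Linear k] (hH : IsFiniteHereditary k H) : IsFiniteHereditary k W where
  hom_finite X Y :=
    have := hH.hom_finite (F.obj X) (F.obj Y)
    Module.Finite.of_injective (F.mapLinearMap k (X := X) (Y := Y)) F.map_injective
  ext_finite := by
    let := HasExt.standard H
    let := HasExt.standard W
    intro X Y n
    by_cases hn : n ≤ 1
    · have := hH.ext_finite (F.obj X) (F.obj Y) n
      exact Module.Finite.of_injective (F.mapExtLinearMap k X Y n)
        (mapExactFunctor_bijective_of_le_one F h X Y n hn).1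
    · have := subsingleton_ext_of_two_le (subsingleton_ext_two F h) X Y n
        (by clear h hH; omega)
      infer_instance
  ext_two := subsingleton_ext_two F h

/-- Only `m = 0` and `m = 1` need the comparison of Ext groups; for other `m` both sides vanish, as
`H` and `W` have no `Ext²`. -/
lemma isHomBijective_single (M N : W) (m : ℤ) : IsHomBijective F.mapDerivedCategory
    ((singleFunctor W 0).obj M) (((singleFunctor W 0).obj N)⟦m⟧) := by
  let := HasExt.standard H
  let := HasExt.standard W
  by_cases hm : m = 0 ∨ m = 1
  · obtain ⟨n, rfl, hn⟩ : ∃ n : ℕ, m = n ∧ n ≤ 1 := by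
      obtain rfl | rfl := hm
      exacts [⟨0, rfl, zero_le_one⟩, ⟨1, rfl, le_rfl⟩]
    have hb := mapExactFunctor_bijective_of_le_one F h M N n hn
    let e : (F.mapDerivedCategory.obj ((singleFunctor W 0).obj M) ⟶
        F.mapDerivedCategory.obj (((singleFunctor W 0).obj N)⟦(n : ℤ)⟧)) ≃
        ShiftedHom ((singleFunctor H 0).obj (F.obj M)) ((singleFunctor H 0).obj (F.obj N))
          (n : ℤ) :=
      Iso.homCongr ((F.mapDerivedCategorySingleFunctor 0).app M) (mapShiftSingleIso F N n)
    have : e ∘ F.mapDerivedCategory.map = Ext.homEquiv ∘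
        (Ext.mapExactFunctor F (X := M) (Y := N) (n := n)) ∘ Ext.homEquiv.symm := by
      ext f
      obtain ⟨ξ, rfl⟩ := (Ext.homEquiv (X := M) (Y := N) (n := n)).surjective f
      simp only [Function.comp_apply, Equiv.symm_apply_apply]
      refine Eq.trans ?_ (Ext.mapExactFunctor_hom F ξ).symm
      simp only [e, Iso.homCongr, mapShiftSingleIso, ShiftedHom.map]
      simp
    refine (Function.Bijective.of_comp_iff' e.bijective _).1 ?_
    rw [this]
    exact (Equiv.bijective _).comp (hb.comp (Equiv.bijective _))
  · have h₁ : ∀ f : (singleFunctor W 0).obj M ⟶ ((singleFunctor W 0).obj N)⟦m⟧, f = 0 := by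
      by_cases hm' : m < 0
      · exact single_hom_shift_eq_zero_of_neg M N m hm'
      · exact single_hom_shift_eq_zero_of_two_le (subsingleton_ext_two F h) M N m
          (by clear h; omega)
    have h₂ : ∀ f : (singleFunctor H 0).obj (F.obj M) ⟶
        ((singleFunctor H 0).obj (F.obj N))⟦m⟧, f = 0 := by
      by_cases hm' : m < 0
      · exact single_hom_shift_eq_zero_of_neg _ _ m hm'
      · exact single_hom_shift_eq_zero_of_two_le h _ _ m (by clear h; omega)
    refine ⟨fun f g _ => (h₁ f).trans (h₁ g).symm, fun f => ⟨0, ?_⟩⟩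
    rw [Functor.map_zero, ← cancel_epi ((F.mapDerivedCategorySingleFunctor 0).inv.app M),
      ← cancel_mono (mapShiftSingleIso F N m).hom, comp_zero, zero_comp]
    exact (h₂ _).symm

lemma isHomBijective_bounded (X Y : DerivedCategory W) (hX : t.bounded X) (hY : t.bounded Y) :
    IsHomBijective F.mapDerivedCategory X Y := by
  refine IsHomBijective.of_bounded (t := t) (fun n m X Y hn hn' hm hm' => ?_) X Y hX hY
  obtain ⟨M, ⟨α⟩⟩ := exists_iso_shift_single X n hn hn'
  obtain ⟨N, ⟨β⟩⟩ := exists_iso_shift_single Y m hm hm'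
  have hnm : (n - m) + -n = -m := by clear h; omega
  exact ((isHomBijective_single F h M N (n - m)).shift (-n)).of_iso α.symm
    ((((shiftFunctorAdd' (DerivedCategory W) (n - m) (-n) (-m) hnm).app
        ((singleFunctor W 0).obj N))).symm ≪≫ β.symm)

lemma faithful_mapBounded : (mapBounded F).Faithful where
  map_injective {X Y} _ _ hfg := Bounded.ι.map_injective
    ((isHomBijective_bounded F h X.obj Y.obj X.property Y.property).1
      (Bounded.ι.congr_map hfg))

lemma full_mapBounded : (mapBounded F).Full where
  map_surjective {X Y} f := by
    obtain ⟨g, hg⟩ := (isHomBijective_bounded F h X.obj Y.obj X.property Y.property).2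
      (Bounded.ι.map f)
    obtain ⟨g, rfl⟩ := Bounded.ι.map_surjective (X := X) (Y := Y) g
    exact ⟨g, Bounded.ι.map_injective hg⟩

/-- If the essential image of `F` is the perpendicular category of `D`, then the essential image of
the functor induced on bounded derived categories consists of the objects right orthogonal to all
shifts of `D`. -/
lemma essImage_mapBounded_iff (D : Bounded H) (hF : ∀ M, F.essImage M ↔ perpZ D M)
    (X : Bounded H) : (mapBounded F).essImage X ↔ shiftPerp D X := by
  have := full_mapBounded F h
  constructor
  · rintro ⟨Y, ⟨α⟩⟩
    refine (shiftPerp D).prop_of_iso α ?_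
    refine (shiftPerp_iff_of_fullyFaithful (G := Bounded.ι) D _).1 ?_
    exact prop_mapDerivedCategory_obj F (shiftPerp D.obj)
      (fun M => (perpZ_iff D _).1 ((hF _).1 (F.obj_mem_essImage M))) Y.obj Y.property
  · have ht := isBoundedHereditary_bounded h
    refine tStructure_induction (t := t.bounded.tStructure t)
      (fun X => shiftPerp D X → (mapBounded F).essImage X) ?_ ?_ X (ht.bounded X)
    · intro n X hn hn' hX
      obtain ⟨M, ⟨α⟩⟩ := exists_iso_shift_single X.obj n
        ((ObjectProperty.tStructure_isGE_iff ..).1 hn)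
        ((ObjectProperty.tStructure_isLE_iff ..).1 hn')
      have hM : perpZ D M := by
        refine (perpZ_iff D M).2
          (((shiftPerp D.obj).prop_shift_iff_of_isStableUnderShift _ (-n)).1 ?_)
        exact (shiftPerp D.obj).prop_of_iso α
          ((shiftPerp_iff_of_fullyFaithful (G := Bounded.ι) D X).2 hX)
      obtain ⟨N, ⟨β⟩⟩ := (hF M).2 hM
      let Y : Bounded W := ⟨((singleFunctor W 0).obj N)⟦-n⟧,
        t.bounded.le_shift (-n) _ (bounded_single N 0)⟩
      refine ⟨Y, ⟨t.bounded.fullyFaithfulι.preimageIso ?_⟩⟩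
      exact mapShiftSingleIso F N (-n) ≪≫
        (shiftFunctor _ (-n)).mapIso ((singleFunctor H 0).mapIso β) ≪≫ α.symm
    · intro n T hT h₁ h₃ _ _ ih₁ ih₃ hX
      -- The triangle splits by heredity, so both truncations are retracts of an object of
      -- `shiftPerp D` and inherit membership.
      obtain ⟨hX₁, hX₃⟩ := ht.retract_of_distTriang hT n h₁ h₃ hX
      exact (mapBounded F).essImage.ext_of_isTriangulatedClosed₂ T hT (ih₁ hX₁) (ih₃ hX₃)

end DerivedFunctor

/-! ### Silting complexes over the perpendicular category -/

section Main

open DerivedCategory DerivedCategory.TStructure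

lemma hom_shift_eq_zero_iff_of_fullyFaithful {C C' : Type*} [Category* C] [Category* C']
    [Preadditive C] [Preadditive C'] [HasShift C ℤ] [HasShift C' ℤ] (G : C ⥤ C') [G.Additive]
    [G.CommShift ℤ] [G.Full] [G.Faithful] (X Y : C) (n : ℤ) :
    (∀ f : G.obj X ⟶ (G.obj Y)⟦n⟧, f = 0) ↔ ∀ f : X ⟶ Y⟦n⟧, f = 0 := by
  constructor
  · intro h f
    apply G.map_injective
    rw [← cancel_mono ((G.commShiftIso n).hom.app Y), Functor.map_zero, zero_comp]
    exact h _
  · intro h f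
    obtain ⟨g, hg⟩ := G.map_surjective (f ≫ (G.commShiftIso n).inv.app Y)
    rw [← cancel_mono ((G.commShiftIso n).inv.app Y), ← hg, h g, Functor.map_zero, zero_comp]

variable {H : Type u} [Category.{v} H] [Abelian H]

/-- The silting reduction of a silting complex `T` over a hereditary category with respect to a
direct summand `D` is a silting complex over the perpendicular category of `D`. -/
lemma exists_silting_perpZ {k : Type*} [Field k] [Linear k H] (hH : IsFiniteHereditary k H)
    {A : Type*} [Ring A] [Algebra k A] (e : A) {T D : Bounded H} (hT : IsSilting T)
    (φ : A ≃ₐ[k] End T) (i : D ⟶ T) (r : T ⟶ D) (hir : i ≫ r = 𝟙 D) (hri : r ≫ i = φ e) :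
    ∃ (_ : (perpZ D).ContainsZero) (_ : (perpZ D).IsClosedUnderKernels)
      (_ : (perpZ D).IsClosedUnderCokernels) (_ : (perpZ D).IsClosedUnderFiniteProducts),
      IsFiniteHereditary k (perpZ D).FullSubcategory ∧
      ∃ T' : Bounded (perpZ D).FullSubcategory,
        IsSilting T' ∧ (IsBasic T → IsBasic T') ∧ (IsTwoTerm T → IsTwoTerm T') ∧
        Nonempty (IdemQuotient e ≃ₐ[k] End T') := by
  have hker := isClosedUnderKernels_perpZ D hH.ext_two
  have hcoker := isClosedUnderCokernels_perpZ D hH.ext_two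
  refine ⟨inferInstance, hker, hcoker, inferInstance, ?_⟩
  have := (perpZ D).preservesKernels_ι
  have := (perpZ D).preservesCokernels_ι
  have : PreservesFiniteLimits (perpZ D).ι :=
    Functor.preservesFiniteLimits_of_preservesKernels _
  have : PreservesFiniteColimits (perpZ D).ι :=
    Functor.preservesFiniteColimits_of_preservesCokernels _
  have hι : (perpZ D).ι.essImage = perpZ D := by
    ext M
    exact ⟨fun ⟨N, ⟨α⟩⟩ => (perpZ D).prop_of_iso α N.property, fun h => ⟨⟨M, h⟩, ⟨Iso.refl _⟩⟩⟩
  have : (perpZ D).ι.essImage.IsClosedUnderExtensions := by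
    rw [hι]
    infer_instance
  have := full_mapBounded (perpZ D).ι hH.ext_two
  have := faithful_mapBounded (perpZ D).ι hH.ext_two
  refine ⟨IsFiniteHereditary.of_fullyFaithful (perpZ D).ι hH.ext_two hH, ?_⟩
  obtain ⟨T', hT', hbasic, hhom, hquot⟩ := exists_silting_reduction
    (F := mapBounded (perpZ D).ι) (isBoundedHereditary_bounded hH.ext_two) k
    hH.finite_hom_bounded (isSplitIdempotent_bounded hH.ext_two) e hT φ i r hir hri
    (essImage_mapBounded_iff (perpZ D).ι hH.ext_two D fun M => by rw [hι])
  refine ⟨T', hT', hbasic, fun hTwo M n h0 h1 => ?_, hquot⟩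
  let Y : Bounded (perpZ D).FullSubcategory := ⟨(singleFunctor _ 0).obj M, bounded_single M 0⟩
  -- By adjunction, vanishing of maps from `T'` to a shift of `M` follows from vanishing of maps
  -- from `T` to the same shift of `M` viewed in `H`.
  refine (hom_shift_eq_zero_iff_of_fullyFaithful Bounded.ι T' Y n).2 (hhom Y n ?_)
  refine (hom_shift_eq_zero_iff_of_fullyFaithful Bounded.ι T _ n).1 fun f => ?_
  let α := (shiftFunctor (DerivedCategory H) n).mapIso
    (((perpZ D).ι.mapDerivedCategorySingleFunctor 0).app M)
  rw [← cancel_mono α.hom, zero_comp]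
  exact hTwo M.obj n h0 h1 _

end Main

end SiltingQuotient

open SiltingQuotient in
theorem theorem3p3 (k : Type*) [Field k] (A : Type*) [Ring A] [Algebra k A]
    (e : A) (he : IsIdempotentElem e) :
    (IsSiltingEndAlgebra.{v, u} k A → IsSiltingEndAlgebra.{v, u} k (IdemQuotient e)) ∧
    (IsQuasiSilted.{v, u} k A → IsQuasiSilted.{v, u} k (IdemQuotient e)) ∧
    ∀ (H : Type u) [Category.{v} H] [Abelian H] [Linear k H], IsFiniteHereditary k H →
      ∀ T : DerivedCategory.Bounded H, IsSilting T → ∀ φ : A ≃ₐ[k] End T,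
        ∃ (D : DerivedCategory.Bounded H) (i : D ⟶ T) (r : T ⟶ D),
          i ≫ r = 𝟙 D ∧ r ≫ i = φ e ∧
          ∃ (_ : (perpZ D).ContainsZero) (_ : (perpZ D).IsClosedUnderKernels)
            (_ : (perpZ D).IsClosedUnderCokernels) (_ : (perpZ D).IsClosedUnderFiniteProducts),
            IsFiniteHereditary k (perpZ D).FullSubcategory ∧
            ∃ T' : DerivedCategory.Bounded (perpZ D).FullSubcategory,
              IsSilting T' ∧ (IsBasic T → IsBasic T') ∧ (IsTwoTerm T → IsTwoTerm T') ∧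
              Nonempty (IdemQuotient e ≃ₐ[k] End T') := by
  have main : ∀ (H : Type u) [Category.{v} H] [Abelian H] [Linear k H], IsFiniteHereditary k H →
      ∀ T : DerivedCategory.Bounded H, IsSilting T → ∀ φ : A ≃ₐ[k] End T,
        ∃ (D : DerivedCategory.Bounded H) (i : D ⟶ T) (r : T ⟶ D),
          i ≫ r = 𝟙 D ∧ r ≫ i = φ e ∧
          ∃ (_ : (perpZ D).ContainsZero) (_ : (perpZ D).IsClosedUnderKernels)
            (_ : (perpZ D).IsClosedUnderCokernels) (_ : (perpZ D).IsClosedUnderFiniteProducts),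
            IsFiniteHereditary k (perpZ D).FullSubcategory ∧
            ∃ T' : DerivedCategory.Bounded (perpZ D).FullSubcategory,
              IsSilting T' ∧ (IsBasic T → IsBasic T') ∧ (IsTwoTerm T → IsTwoTerm T') ∧
              Nonempty (IdemQuotient e ≃ₐ[k] End T') := by
    intro H _ _ _ hH T hT φ
    have hφ : φ e * φ e = φ e := by rw [← map_mul, he.eq]
    obtain ⟨D, i, r, hir, hri⟩ := isSplitIdempotent_bounded hH.ext_two T (φ e) hφ
    exact ⟨D, i, r, hir, hri, exists_silting_perpZ hH e hT φ i r hir hri⟩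
  refine ⟨?_, ?_, main⟩
  · rintro ⟨H, _, _, _, T, hH, hT, hb, ⟨φ⟩⟩
    obtain ⟨D, i, r, -, -, _, _, _, _, hW, T', hT', hb', -, hφ'⟩ := main H hH T hT φ
    exact ⟨(perpZ D).FullSubcategory, inferInstance, inferInstance, inferInstance, T', hW, hT',
      hb' hb, hφ'⟩
  · rintro ⟨H, _, _, _, T, hH, hT, htwo, hb, ⟨φ⟩⟩
    obtain ⟨D, i, r, -, -, _, _, _, _, hW, T', hT', hb', htwo', hφ'⟩ := main H hH T hT φ
    exact ⟨(perpZ D).FullSubcategory, inferInstance, inferInstance, inferInstance, T', hW, hT',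
      htwo' htwo, hb' hb, hφ'⟩
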